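/- Let $K$ be fixed. For $k=1,\dots,K$ let $F_k$ be a probability distribution on $\mathbb{R}^d$, and let $X_{k,i}$ ($1\le k\le K$, $i\ge 1$) be independent random vectors with $X_{k,i}\sim F_k$. Let $p=p_1+p_2$ and let $M:\mathbb{R}^d\times\mathbb{R}^{p}\to\mathbb{R}$, $(x,\theta)\mapsto M(x;\theta)$ with $\theta=(\phi,\lambda)$, $\phi\in\mathbb{R}^{p_1}$, $\lambda\in\mathbb{R}^{p_2}$. Let $\Theta_k\subset\mathbb{R}^p$ and $\theta_k^*=(\phi^*,\lambda_k^*)$, where $\phi^*$ does not depend on $k$; put $M_k(\theta)=\mathbb{E}M(X_{k,1};\theta)$. All gradients and Hessians are with respect to $\theta$; matrix norms are spectral norms. Assume for every $k$: (0) $M(x;\cdot)$ is convex on $\Theta_k$ for every $x$, and $M(X_{k,1};\theta)$ is integrable for every $\theta\in\Theta_k$. (1) Along the sequence of experiments considered, block $k$ has sample size $n_k$, $N=\sum_k n_k\to\infty$ and $n_k/N\to\gamma_k>0$. (2) $\theta_k^*$ is the unique minimizer of $M_k$ on $\Theta_k$. (3) $\Theta_k$ is compact and convex, and $\theta_k^*$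 is an interior point of it. (4) $M_k$ is twice differentiable at $\theta_k^*$ and $\nabla^2M_k(\theta_k^*)\succeq\rho_- I$ for some $\rho_->0$ independent of $k$. (5) For some $v,v_1\ge 2$ there are constants $R,L,G_0,B_0,\rho>0$ and measurable functions $G,B$ on $\mathbb{R}^d$, all independent of $k$, such that $M(x;\cdot)$ is twice differentiable on $U_k=\{\theta:\|\theta-\theta_k^*\|_2\le\rho\}$ for every $x$; $\mathbb{E}\|\nabla M(X_{k,1};\theta_k^*)\|^{2v_1}\le R^{2v_1}$; $\mathbb{E}\|\nabla^2M(X_{k,1};\theta_k^*)-\nabla^2M_k(\theta_k^*)\|^{2v}\le L^{2v}$; for every $x$ the maps $\theta\mapsto\nabla^2M(x;\theta)$ and $\theta\mapsto\nabla M(x;\theta)\nabla M(x;\theta)^T$ are Lipschitz on $U_k$ with constants $G(x)$ and $B(x)$; and $\mathbb{E}|G(X_{k,1})|^{2v}\le G_0^{2v}$, $\mathbb{E}|B(X_{k,1})|^{2v}\le B_0^{2v}$. Let $(\hat\phi_k,\hat\lambda_k)$ be a random vector that almost surely minimizes $\sum_{i=1}^{n_k}M(X_{k,i};\theta)$ over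 $\theta\in\Theta_k$, and let $\hat\phi^{SaC}=N^{-1}\sum_k n_k\hat\phi_k$. Let $(\hat\phi_{full},\hat\lambda_{1,full},\dots,\hat\lambda_{K,full})$ be a random vector that almost surely minimizes $\sum_{k}\sum_{i=1}^{n_k}M(X_{k,i};\phi,\lambda_k)$ over all $(\phi,\lambda_1,\dots,\lambda_K)$ with $(\phi,\lambda_k)\in\Theta_k$ for every $k$. Write $$\mathbb{E}\nabla^2M(X_{k,1};\theta_k^*)=\begin{pmatrix}\Psi_\phi^\phi&\Psi_\phi^\lambda\\ \Psi_\lambda^\phi&\Psi_\lambda^\lambda\end{pmatrix},\qquad J_k=J_{\phi|\lambda}(\theta_k^*)=\Psi_\phi^\phi-\Psi_\phi^\lambda(\Psi_\lambda^\lambda)^{-1}\Psi_\lambda^\phi,$$ $$\Sigma_k=\mathrm{Var}\Big\{\partial_\phi M(X_{k,1};\theta_k^*)-\Psi_\phi^\lambda(\Psi_\lambda^\lambda)^{-1}\partial_\lambda M(X_{k,1};\theta_k^*)\Big\}.$$ Then $\Psi_\lambda^\lambda$ and $J_k$ are positive definite for every $k$, and $$\sqrt N(\hat\phi^{SaC}-\phi^*)\xrightarrow{d}\mathcal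 N\Big(0,\sum_k\gamma_kJ_k^{-1}\Sigma_kJ_k^{-1}\Big),$$ $$\sqrt N(\hat\phi_{full}-\phi^*)\xrightarrow{d}\mathcal N\Big(0,\big(\sum_k\gamma_kJ_k\big)^{-1}\big(\sum_k\gamma_k\Sigma_k\big)\big(\sum_k\gamma_kJ_k\big)^{-1}\Big).$$ Moreover, the full-sample estimator need not be more efficient than the SaC estimator: there are $d,p_1,p_2,K$ with $p_2\ge 1$, and $M,F_k,\Theta_k,\theta_k^*,n_k,\gamma_k$ satisfying (0)-(5), for which $$\big(\sum_k\gamma_kJ_k\big)^{-1}\big(\sum_k\gamma_k\Sigma_k\big)\big(\sum_k\gamma_kJ_k\big)^{-1}\preceq\sum_k\gamma_kJ_k^{-1}\Sigma_kJ_k^{-1}$$ fails, where $A\preceq B$ means that $B-A$ is positive semidefinite. -/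

import Mathlib

open MeasureTheory ProbabilityTheory Filter Topology
open scoped Matrix.Norms.L2Operator

namespace SaC

/-- The space `ℝ^d` of observations. -/
abbrev Obs (d : ℕ) : Type := EuclideanSpace ℝ (Fin d)

/-- The space `ℝ^{p₁+p₂}` of block parameters `θ_k = (φ, λ_k)` with the Euclidean norm; the
coordinates of `φ` are indexed by `Sum.inl`, those of `λ_k` by `Sum.inr`. -/
abbrev Param (p₁ p₂ : ℕ) : Type := EuclideanSpace ℝ (Fin p₁ ⊕ Fin p₂)

noncomputable section

variable {d p₁ p₂ K : ℕ}

/-- The block parameter `(φ, λ)`. -/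
def join (φ : EuclideanSpace ℝ (Fin p₁)) (l : EuclideanSpace ℝ (Fin p₂)) : Param p₁ p₂ :=
  WithLp.toLp 2 (Sum.elim φ l)

/-- The component `φ` of `θ = (φ, λ)`. -/
def common (θ : Param p₁ p₂) : EuclideanSpace ℝ (Fin p₁) :=
  WithLp.toLp 2 (fun a => θ (Sum.inl a))

/-! ### Derivatives -/

/-- `f` is twice differentiable at `θ`. -/
def TwiceDifferentiableAt (f : Param p₁ p₂ → ℝ) (θ : Param p₁ p₂) : Prop :=
  (∀ᶠ η in 𝓝 θ, DifferentiableAt ℝ f η) ∧ DifferentiableAt ℝ (gradient f) θ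

/-- The Hessian matrix `∇²f(θ)`, the Jacobian matrix of the gradient. -/
def hess (f : Param p₁ p₂ → ℝ) (θ : Param p₁ p₂) :
    Matrix (Fin p₁ ⊕ Fin p₂) (Fin p₁ ⊕ Fin p₂) ℝ :=
  Matrix.of fun a b => (fderiv ℝ (gradient f) θ (EuclideanSpace.single b 1)) a

/-- The outer product `∇f(θ) ∇f(θ)ᵀ`. -/
def gradOuter (f : Param p₁ p₂ → ℝ) (θ : Param p₁ p₂) :
    Matrix (Fin p₁ ⊕ Fin p₂) (Fin p₁ ⊕ Fin p₂) ℝ :=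
  Matrix.of fun a b => gradient f θ a * gradient f θ b

/-! ### Population quantities of one block with distribution `F` -/

/-- The population objective `E_F M(X; θ)`. -/
def popRisk (F : Measure (Obs d)) (M : Obs d → Param p₁ p₂ → ℝ) (θ : Param p₁ p₂) : ℝ :=
  ∫ x, M x θ ∂F

/-- `Ψ_θ^θ(θ) = E_F ∇²M(X; θ)`, entry by entry. -/
def popHess (F : Measure (Obs d)) (M : Obs d → Param p₁ p₂ → ℝ) (θ : Param p₁ p₂) :
    Matrix (Fin p₁ ⊕ Fin p₂) (Fin p₁ ⊕ Fin p₂) ℝ :=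
  Matrix.of fun a b => ∫ x, hess (M x) θ a b ∂F

/-- The partial Hessian `J_{φ|λ} = Ψ_φ^φ - Ψ_φ^λ (Ψ_λ^λ)⁻¹ Ψ_λ^φ`. -/
def partialHess (F : Measure (Obs d)) (M : Obs d → Param p₁ p₂ → ℝ) (θ : Param p₁ p₂) :
    Matrix (Fin p₁) (Fin p₁) ℝ :=
  (popHess F M θ).toBlocks₁₁ -
    (popHess F M θ).toBlocks₁₂ * ((popHess F M θ).toBlocks₂₂)⁻¹ * (popHess F M θ).toBlocks₂₁

/-- The adjusted score `S_φ(x; θ) = ψ_φ(x; θ) - Ψ_φ^λ (Ψ_λ^λ)⁻¹ ψ_λ(x; θ)`. -/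
def adjScore (F : Measure (Obs d)) (M : Obs d → Param p₁ p₂ → ℝ) (θ : Param p₁ p₂)
    (x : Obs d) : Fin p₁ → ℝ :=
  (fun a => gradient (M x) θ (Sum.inl a)) -
    ((popHess F M θ).toBlocks₁₂ * ((popHess F M θ).toBlocks₂₂)⁻¹).mulVec
      (fun b => gradient (M x) θ (Sum.inr b))

/-- The covariance matrix `Var_F S_φ(X; θ)`. -/
def scoreVar (F : Measure (Obs d)) (M : Obs d → Param p₁ p₂ → ℝ) (θ : Param p₁ p₂) :
    Matrix (Fin p₁) (Fin p₁) ℝ :=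
  Matrix.of fun a b => covariance (fun x => adjScore F M θ x a) (fun x => adjScore F M θ x b) F

/-- `∑_k γ_k J_k⁻¹ Σ_k J_k⁻¹`. -/
def covSaC (F : Fin K → Measure (Obs d)) (M : Obs d → Param p₁ p₂ → ℝ)
    (θs : Fin K → Param p₁ p₂) (γ : Fin K → ℝ) : Matrix (Fin p₁) (Fin p₁) ℝ :=
  ∑ k, γ k • ((partialHess (F k) M (θs k))⁻¹ * scoreVar (F k) M (θs k) *
    (partialHess (F k) M (θs k))⁻¹)

/-- `(∑_k γ_k J_k)⁻¹ (∑_k γ_k Σ_k) (∑_k γ_k J_k)⁻¹`. -/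
def covFull (F : Fin K → Measure (Obs d)) (M : Obs d → Param p₁ p₂ → ℝ)
    (θs : Fin K → Param p₁ p₂) (γ : Fin K → ℝ) : Matrix (Fin p₁) (Fin p₁) ℝ :=
  (∑ k, γ k • partialHess (F k) M (θs k))⁻¹ * (∑ k, γ k • scoreVar (F k) M (θs k)) *
    (∑ k, γ k • partialHess (F k) M (θs k))⁻¹

/-! ### Assumptions -/

/-- Sample sizes `n m k` of the blocks along a sequence of experiments `m = 0, 1, …`: the total
sample size `N` tends to infinity and `n_k / N → γ_k > 0`. -/
structure SampleSizes (n : ℕ → Fin K → ℕ) (γ : Fin K → ℝ) : Prop where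
  total_tendsto : Tendsto (fun m => ∑ k, n m k) atTop atTop
  ratio_tendsto : ∀ k, Tendsto (fun m => (n m k : ℝ) / ((∑ j, n m j : ℕ) : ℝ)) atTop (𝓝 (γ k))
  limit_pos : ∀ k, 0 < γ k

/-- `θ_k*` is the unique minimizer of `θ ↦ E M(X_{k,1}; θ)` (which is well defined) on `Θ_k`. -/
structure Identifiability (M : Obs d → Param p₁ p₂ → ℝ) (F : Fin K → Measure (Obs d))
    (Θ : Fin K → Set (Param p₁ p₂)) (θs : Fin K → Param p₁ p₂) : Prop where
  integrable : ∀ k, ∀ θ ∈ Θ k, Integrable (fun x => M x θ) (F k)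
  unique_min : ∀ k, ∀ θ ∈ Θ k, θ ≠ θs k → popRisk (F k) M (θs k) < popRisk (F k) M θ

/-- `Θ_k` is compact and convex with `θ_k*` in its interior. -/
structure Compactness (Θ : Fin K → Set (Param p₁ p₂)) (θs : Fin K → Param p₁ p₂) : Prop where
  compact : ∀ k, IsCompact (Θ k)
  convex : ∀ k, Convex ℝ (Θ k)
  interior : ∀ k, θs k ∈ interior (Θ k)

/-- The population objectives are twice differentiable at `θ_k*`, with `∇²M_k(θ_k*) ⪰ ρ₋ I`. -/
def LocalStrongConvexity (M : Obs d → Param p₁ p₂ → ℝ) (F : Fin K → Measure (Obs d))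
    (θs : Fin K → Param p₁ p₂) : Prop :=
  ∃ ρ : ℝ, 0 < ρ ∧ ∀ k, TwiceDifferentiableAt (popRisk (F k) M) (θs k) ∧
    (hess (popRisk (F k) M) (θs k) - ρ • (1 : Matrix _ _ ℝ)).PosSemidef

/-- Moment and Lipschitz conditions on the first two derivatives of `M`, with exponents `v, v₁`.
Norms of matrices are spectral norms. -/
def Smoothness (M : Obs d → Param p₁ p₂ → ℝ) (F : Fin K → Measure (Obs d))
    (θs : Fin K → Param p₁ p₂) (v v₁ : ℝ) : Prop :=
  ∃ (R L G₀ B₀ ρ : ℝ) (G B : Obs d → ℝ),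
    0 < R ∧ 0 < L ∧ 0 < G₀ ∧ 0 < B₀ ∧ 0 < ρ ∧ Measurable G ∧ Measurable B ∧
    ∀ k,
      (∀ x, ∀ θ ∈ Metric.closedBall (θs k) ρ, TwiceDifferentiableAt (M x) θ) ∧
      ∫⁻ x, ‖gradient (M x) (θs k)‖ₑ ^ (2 * v₁) ∂(F k) ≤ ENNReal.ofReal (R ^ (2 * v₁)) ∧
      ∫⁻ x, ‖hess (M x) (θs k) - hess (popRisk (F k) M) (θs k)‖ₑ ^ (2 * v) ∂(F k)
        ≤ ENNReal.ofReal (L ^ (2 * v)) ∧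
      (∀ x, ∀ θ ∈ Metric.closedBall (θs k) ρ, ∀ θ' ∈ Metric.closedBall (θs k) ρ,
        ‖hess (M x) θ - hess (M x) θ'‖ ≤ G x * ‖θ - θ'‖ ∧
        ‖gradOuter (M x) θ - gradOuter (M x) θ'‖ ≤ B x * ‖θ - θ'‖) ∧
      ∫⁻ x, ‖G x‖ₑ ^ (2 * v) ∂(F k) ≤ ENNReal.ofReal (G₀ ^ (2 * v)) ∧
      ∫⁻ x, ‖B x‖ₑ ^ (2 * v) ∂(F k) ≤ ENNReal.ofReal (B₀ ^ (2 * v))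

/-- The heterogeneous M-estimation model: block distributions `F_k`, a common objective `M` which
is convex in the parameter, parameter sets `Θ_k`, and true parameters `θ_k* = (φ*, λ_k*)`. -/
structure Model (M : Obs d → Param p₁ p₂ → ℝ) (F : Fin K → Measure (Obs d))
    (Θ : Fin K → Set (Param p₁ p₂)) (φs : EuclideanSpace ℝ (Fin p₁))
    (ls : Fin K → EuclideanSpace ℝ (Fin p₂)) (v v₁ : ℝ) : Prop where
  prob : ∀ k, IsProbabilityMeasure (F k)
  convex_obj : ∀ k x, ConvexOn ℝ (Θ k) (M x)
  identifiability : Identifiability M F Θ (fun k => join φs (ls k))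
  compactness : Compactness Θ (fun k => join φs (ls k))
  strong_convexity : LocalStrongConvexity M F (fun k => join φs (ls k))
  smoothness : Smoothness M F (fun k => join φs (ls k)) v v₁

/-! ### Data and estimators -/

/-- All observations `X_{k,i}` are independent, and `X_{k,i}` has distribution `F_k`. -/
structure IsSample {Ω : Type*} [MeasurableSpace Ω] (P : Measure Ω)
    (X : Fin K → ℕ → Ω → Obs d) (F : Fin K → Measure (Obs d)) : Prop where
  law : ∀ k i, HasLaw (X k i) (F k) P
  indep : iIndepFun (fun q : Fin K × ℕ => X q.1 q.2) P

/-- `∑_{i=1}^{n} M(x_i; θ)`. -/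
def empObj (M : Obs d → Param p₁ p₂ → ℝ) (x : ℕ → Obs d) (n : ℕ) (θ : Param p₁ p₂) : ℝ :=
  ∑ i ∈ Finset.range n, M (x i) θ

/-- `T m k` is the local M-estimator `(φ̂_k, λ̂_k)`: a random vector which almost surely minimizes
the objective of the `k`-th block over `Θ_k`. -/
structure IsLocalEstimator {Ω : Type*} [MeasurableSpace Ω] (P : Measure Ω)
    (M : Obs d → Param p₁ p₂ → ℝ) (Θ : Fin K → Set (Param p₁ p₂))
    (X : Fin K → ℕ → Ω → Obs d) (n : ℕ → Fin K → ℕ)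
    (T : ℕ → Fin K → Ω → Param p₁ p₂) : Prop where
  aemeasurable : ∀ m k, AEMeasurable (T m k) P
  argmin : ∀ m k, ∀ᵐ ω ∂P, T m k ω ∈ Θ k ∧
    IsMinOn (empObj M (fun i => X k i ω) (n m k)) (Θ k) (T m k ω)

/-- The full parameter space: all `(φ, λ_1, …, λ_K)` with `(φ, λ_k) ∈ Θ_k` for every `k`. -/
def fullSpace (Θ : Fin K → Set (Param p₁ p₂)) :
    Set (EuclideanSpace ℝ (Fin p₁) × (Fin K → EuclideanSpace ℝ (Fin p₂))) :=
  {t | ∀ k, join t.1 (t.2 k) ∈ Θ k}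

/-- `T m` is the full-sample M-estimator `(φ̂, λ̂_1, …, λ̂_K)`: a random vector which almost surely
minimizes `∑_k ∑_i M(X_{k,i}; φ, λ_k)` over the full parameter space. -/
structure IsFullEstimator {Ω : Type*} [MeasurableSpace Ω] (P : Measure Ω)
    (M : Obs d → Param p₁ p₂ → ℝ) (Θ : Fin K → Set (Param p₁ p₂))
    (X : Fin K → ℕ → Ω → Obs d) (n : ℕ → Fin K → ℕ)
    (T : ℕ → Ω → EuclideanSpace ℝ (Fin p₁) × (Fin K → EuclideanSpace ℝ (Fin p₂))) : Prop where
  aemeasurable : ∀ m, AEMeasurable (T m) P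
  argmin : ∀ m, ∀ᵐ ω ∂P, T m ω ∈ fullSpace Θ ∧
    IsMinOn (fun t => ∑ k, empObj M (fun i => X k i ω) (n m k) (join t.1 (t.2 k)))
      (fullSpace Θ) (T m ω)

/-- The split-and-conquer estimator `N⁻¹ ∑_k n_k φ̂_k`. -/
def sacEstimator {Ω : Type*} (n : ℕ → Fin K → ℕ) (T : ℕ → Fin K → Ω → Param p₁ p₂)
    (m : ℕ) (ω : Ω) : EuclideanSpace ℝ (Fin p₁) :=
  ((∑ k, n m k : ℕ) : ℝ)⁻¹ • ∑ k, (n m k : ℝ) • common (T m k ω)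

end

end SaC

/-! Convexity replaces the usual consistency argument. Suppose convex functions have gradients near
their centres that are linear up to a quadratic error, with uniformly positive linear parts. Any
minimizer of their sum over displacements in a linear subspace then lies within a constant times the
norms of the gradients at the centres: a minimizer further out would contradict the tangent-plane
inequality at an intermediate point of the segment leading to it (`constrained_argmin_bound`). A
minimizer that close is interior to the balls, so the directional derivatives along the subspace
vanish there. Replacing the gradients in this condition by their linear parts costs a term of
smaller order than the gradients at the centres (`isLittleO_constrained_argmin`).

Both estimators have this form: the local estimators jointly minimize over all displacements, and
the full estimator minimizes over the displacements whose `φ`-component is the same in every block.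
The strong law makes the linearization valid almost surely, relative to the size of the averaged
scores. Those scores are of order `N^(-1/2)` in `L²`, so after multiplication by `√N` the error
tends to zero in probability (`tendstoInMeasure_argmin`).

The nuisance parameters are removed by testing against the least favourable directions `w = (u,
-Ψ₂₂⁻¹ Ψ₂₁ u)`, for which `Ψ w = (J u, 0)`: the Hessian term sees only the `φ`-displacement, and the
score in direction `w` is the adjusted score. Taking `u = J_k⁻¹ v` in block `k` gives the averaged
local estimator. Taking `u = (∑ γ_k J_k)⁻¹ v` in every block gives the full estimator, because the
test direction must share one `φ`-component. A central limit theorem for independent blocks and the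
Cramér–Wold device finish the normality claims (`tendstoInDistribution_of_linear`).

For the negative claim, take least squares with an intercept, with regressor and noise independent
and uniform on `{c, -c}`. Then `J = c²` and `Σ = c⁴`, so each local slope has asymptotic variance 1
whatever `c` is, and equal averaging of two equal-sized blocks gives 1. The full estimator weights
blocks by `J = c²`, favouring a block that is no more accurate. With `c = 1, 2` its variance is
`(17/2) / (5/2)² = 34/25 > 1`. -/

namespace SaC

open scoped InnerProductSpace

/-! ### Minimizers of sums of convex functions -/

section Argmin

variable {E : Type*} [NormedAddCommGroup E] [InnerProductSpace ℝ E] [CompleteSpace E]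

/-- A convex function lies above its tangent planes. -/
theorem inner_gradient_le_of_convexOn {f : E → ℝ} {S : Set E} (hf : ConvexOn ℝ S f) {x y g : E}
    (hx : x ∈ S) (hy : y ∈ S) (hg : HasGradientAt f g x) : ⟪g, y - x⟫_ℝ ≤ f y - f x := by
  have h1 : HasDerivAt (fun t : ℝ => f (x + t • (y - x))) ⟪g, y - x⟫_ℝ 0 := by
    have h2 : HasDerivAt (fun t : ℝ => x + t • (y - x)) (y - x) 0 := by
      simpa using ((hasDerivAt_id (0 : ℝ)).smul_const (y - x)).const_add x
    have h3 : HasFDerivAt f (InnerProductSpace.toDual ℝ E g) (x + (0 : ℝ) • (y - x)) := by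
      simpa using hg.hasFDerivAt
    have h4 := h3.comp_hasDerivAt (0 : ℝ) h2
    rw [InnerProductSpace.toDual_apply_apply] at h4
    exact h4
  have h4 := h1.hasDerivWithinAt (s := Set.Ioi 0)
  rw [hasDerivWithinAt_iff_tendsto_slope] at h4
  have h0 : Set.Ioi (0 : ℝ) \ {0} = Set.Ioi 0 := by
    ext z; simp only [Set.mem_sdiff, Set.mem_Ioi, Set.mem_singleton_iff]
    exact ⟨fun h => h.1, fun h => ⟨h, h.ne'⟩⟩
  rw [h0] at h4
  refine le_of_tendsto h4 ?_
  filter_upwards [Ioo_mem_nhdsGT (zero_lt_one' ℝ)] with t ht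
  obtain ⟨-, hf2⟩ := hf
  have h5 := hf2 hx hy (a := 1 - t) (b := t) (by linarith [ht.2]) ht.1.le (by ring)
  have h6 : (1 - t) • x + t • y = x + t • (y - x) := by
    rw [sub_smul, smul_sub, one_smul]; abel
  rw [h6] at h5
  simp only [slope, vsub_eq_sub, sub_zero, zero_smul, add_zero, smul_eq_mul] at h5 ⊢
  rw [inv_mul_le_iff₀ ht.1]
  linarith

variable {κ : Type*} [Fintype κ]

/-- A minimizer of `∑ j, f j (θ j + δ j)` over the `δ` in a subspace, where the functions `f j`
are convex and have approximately linear gradients near `θ j`, is close to `0` as soon as the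
gradients at `θ j` are small, and it satisfies the first order condition. -/
theorem constrained_argmin_bound (V : Submodule ℝ (κ → E)) {Θ : κ → Set E} {θ : κ → E}
    {f : κ → E → ℝ} {g : κ → E → E} {A : κ → E → E} {r c C : ℝ}
    (hc : 0 < c) (hCr : C * r ≤ c / 2) (hC : 0 ≤ C)
    (hball : ∀ j, Metric.closedBall (θ j) r ⊆ Θ j)
    (hconv : ∀ j, ConvexOn ℝ (Θ j) (f j))
    (hgrad : ∀ j, ∀ η ∈ Metric.closedBall (θ j) r, HasGradientAt (f j) (g j η) η)
    (hexp : ∀ j h, ‖h‖ ≤ r → ‖g j (θ j + h) - g j (θ j) - A j h‖ ≤ C * ‖h‖ ^ 2)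
    (hpos : ∀ j h, c * ‖h‖ ^ 2 ≤ ⟪A j h, h⟫_ℝ)
    (hsmall : 2 * ∑ j, ‖g j (θ j)‖ < c * r)
    {δ : κ → E} (hδ : δ ∈ V) (hfeas : ∀ j, θ j + δ j ∈ Θ j)
    (hmin : ∀ δ' ∈ V, (∀ j, θ j + δ' j ∈ Θ j) →
      ∑ j, f j (θ j + δ j) ≤ ∑ j, f j (θ j + δ' j)) :
    (∀ j, ‖δ j‖ ≤ 2 / c * ∑ j, ‖g j (θ j)‖) ∧
      ∀ h ∈ V, ∑ j, ⟪g j (θ j + δ j), h j⟫_ℝ = 0 := by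
  classical
  set b := ∑ j, ‖g j (θ j)‖ with hb
  have hb0 : 0 ≤ b := Finset.sum_nonneg fun j _ => norm_nonneg _
  -- The `ℓ²` norm of the whole family is used because the coercive lower bounds of the blocks add
  -- up to exactly `c * s ^ 2`.
  set s := ‖(WithLp.toLp 2 δ : PiLp 2 fun _ : κ => E)‖ with hs
  have hsj : ∀ j, ‖δ j‖ ≤ s := fun j =>
    PiLp.norm_apply_le (WithLp.toLp 2 δ : PiLp 2 fun _ : κ => E) j
  have hs2 : s ^ 2 = ∑ j, ‖δ j‖ ^ 2 := by
    rw [hs, PiLp.norm_sq_eq_of_L2]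
  have hr : 2 / c * b < r := by
    rw [div_mul_eq_mul_div, div_lt_iff₀ hc]; linarith
  have hβ : 0 ≤ 2 / c * b := by positivity
  have key : s ≤ 2 / c * b := by
    by_contra! hlt
    -- The point `τ • δ` of norm `u` lies strictly between `0` and `δ`, within the range of the
    -- expansion, yet beyond the claimed bound. There the slope towards `δ` is positive by the
    -- expansion (`h4`) and nonpositive by convexity and minimality (`h5`).
    obtain ⟨u, hu1, hu2, hu3⟩ : ∃ u, 2 / c * b < u ∧ u < s ∧ u ≤ r := by
      obtain ⟨u, hu, hu'⟩ := exists_between (lt_min hlt hr)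
      exact ⟨u, hu, hu'.trans_le (min_le_left _ _), (hu'.trans_le (min_le_right _ _)).le⟩
    have hu0 : 0 < u := hβ.trans_lt hu1
    have hs0 : 0 < s := hu0.trans hu2
    set τ := u / s with hτ
    have hτ0 : 0 < τ := by positivity
    have hτ1 : τ < 1 := (div_lt_one hs0).2 hu2
    have hτs : τ * s = u := div_mul_cancel₀ _ hs0.ne'
    have hnorm : ∀ j, ‖τ • δ j‖ ≤ u := fun j => by
      rw [norm_smul, Real.norm_of_nonneg hτ0.le, ← hτs]
      exact mul_le_mul_of_nonneg_left (hsj j) hτ0.le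
    have hmem : ∀ j, θ j + τ • δ j ∈ Metric.closedBall (θ j) r := fun j => by
      simpa [mem_closedBall_iff_norm] using (hnorm j).trans hu3
    have h1 : ∀ j, (1 - τ) * ⟪g j (θ j + τ • δ j), δ j⟫_ℝ
        ≤ f j (θ j + δ j) - f j (θ j + τ • δ j) := fun j => by
      have := inner_gradient_le_of_convexOn (hconv j) (hball j (hmem j)) (hfeas j)
        (hgrad j _ (hmem j))
      have e : θ j + δ j - (θ j + τ • δ j) = (1 - τ) • δ j := by
        rw [sub_smul, one_smul]; abel
      rwa [e, inner_smul_right] at this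
    have h2 : ∑ j, (1 - τ) * ⟪g j (θ j + τ • δ j), δ j⟫_ℝ ≤ 0 := by
      refine (Finset.sum_le_sum fun j _ => h1 j).trans ?_
      rw [Finset.sum_sub_distrib]
      have := hmin (τ • δ) (V.smul_mem _ hδ) fun j => hball j (hmem j)
      simp only [Pi.smul_apply] at this
      linarith
    have h3 : ∀ j, -(‖g j (θ j)‖ * u) + c / 2 * ‖τ • δ j‖ ^ 2
        ≤ ⟪g j (θ j + τ • δ j), τ • δ j⟫_ℝ := fun j => by
      have e : g j (θ j + τ • δ j) = g j (θ j) + A j (τ • δ j)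
          + (g j (θ j + τ • δ j) - g j (θ j) - A j (τ • δ j)) := by abel
      rw [e, inner_add_left, inner_add_left]
      have i1 := hpos j (τ • δ j)
      have i2 := abs_le.1 (abs_real_inner_le_norm (g j (θ j)) (τ • δ j))
      have i3 := abs_le.1 (abs_real_inner_le_norm
        (g j (θ j + τ • δ j) - g j (θ j) - A j (τ • δ j)) (τ • δ j))
      have i4 := hexp j (τ • δ j) ((hnorm j).trans hu3)
      have i5 := mul_le_mul_of_nonneg_left (hnorm j) (norm_nonneg (g j (θ j)))
      have i6 := mul_le_mul_of_nonneg_right i4 (norm_nonneg (τ • δ j))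
      have i7 : C * ‖τ • δ j‖ ^ 2 * ‖τ • δ j‖ ≤ c / 2 * ‖τ • δ j‖ ^ 2 := by
        have : C * ‖τ • δ j‖ ≤ c / 2 :=
          (mul_le_mul_of_nonneg_left ((hnorm j).trans hu3) hC).trans hCr
        nlinarith [mul_le_mul_of_nonneg_right this (sq_nonneg ‖τ • δ j‖)]
      linarith [i2.1, i3.1]
    have h4 : -(b * u) + c / 2 * u ^ 2 ≤ ∑ j, ⟪g j (θ j + τ • δ j), τ • δ j⟫_ℝ := by
      refine le_trans (le_of_eq ?_) (Finset.sum_le_sum fun j _ => h3 j)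
      rw [Finset.sum_add_distrib, Finset.sum_neg_distrib, ← Finset.sum_mul, ← Finset.mul_sum]
      congr 2
      simp_rw [norm_smul, mul_pow, ← Finset.mul_sum, ← hs2]
      rw [Real.norm_of_nonneg hτ0.le, ← mul_pow, hτs]
    rw [← Finset.mul_sum] at h2
    simp_rw [inner_smul_right, ← Finset.mul_sum] at h4
    have h5 : ∑ j, ⟪g j (θ j + τ • δ j), δ j⟫_ℝ ≤ 0 := by
      by_contra! hh
      exact absurd h2 (not_le.2 (mul_pos (by linarith) hh))
    have h6 : -(b * u) + c / 2 * u ^ 2 ≤ 0 :=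
      h4.trans (mul_nonpos_of_nonneg_of_nonpos hτ0.le h5)
    have h7 : 2 * b < c * u := by
      rw [div_mul_eq_mul_div, div_lt_iff₀ hc] at hu1; linarith
    nlinarith [mul_pos hu0 (sub_pos.2 h7)]
  refine ⟨fun j => (hsj j).trans key, fun h hh => ?_⟩
  have hsr : ∀ j, ‖δ j‖ < r := fun j => ((hsj j).trans key).trans_lt hr
  have hd : HasDerivAt (fun t : ℝ => ∑ j, f j (θ j + (δ j + t • h j)))
      (∑ j, ⟪g j (θ j + δ j), h j⟫_ℝ) 0 := by
    refine HasDerivAt.fun_sum fun j _ => ?_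
    have h2 : HasDerivAt (fun t : ℝ => θ j + (δ j + t • h j)) (h j) 0 := by
      simpa using (((hasDerivAt_id (0 : ℝ)).smul_const (h j)).const_add (δ j)).const_add (θ j)
    have h3 : HasFDerivAt (f j) (InnerProductSpace.toDual ℝ E (g j (θ j + δ j)))
        (θ j + (δ j + (0 : ℝ) • h j)) := by
      have := (hgrad j (θ j + δ j)
        (by simpa [mem_closedBall_iff_norm] using (hsr j).le)).hasFDerivAt
      simpa using this
    have h4 := h3.comp_hasDerivAt (0 : ℝ) h2
    rw [InnerProductSpace.toDual_apply_apply] at h4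
    exact h4
  refine IsLocalMin.hasDerivAt_eq_zero ?_ hd
  -- The bound just proved is strictly below `r`, so small moves along `V` remain feasible and the
  -- derivative must vanish in both directions.
  have hev : ∀ᶠ t : ℝ in 𝓝 0, ∀ j, ‖δ j + t • h j‖ < r := by
    refine eventually_all.2 fun j => ?_
    have hcont : Continuous fun t : ℝ => ‖δ j + t • h j‖ := by fun_prop
    exact hcont.continuousAt.eventually_lt continuousAt_const (by simpa using hsr j)
  filter_upwards [hev] with t ht
  simp only [zero_smul, add_zero]
  exact hmin (δ + t • h) (V.add_mem hδ (V.smul_mem _ hh)) fun j =>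
    hball j (by simpa [mem_closedBall_iff_norm] using (ht j).le)

/-- Linearization of minimizers along a sequence of convex objectives: the first order condition
holds with the gradients replaced by their linear approximations, up to an error of smaller order
than the gradients at the centre. -/
theorem isLittleO_constrained_argmin (V : Submodule ℝ (κ → E)) {Θ : κ → Set E} {θ : κ → E}
    {f : ℕ → κ → E → ℝ} {g : ℕ → κ → E → E} {A Q : ℕ → κ → E →L[ℝ] E} {H : κ → E →L[ℝ] E}
    {C : ℕ → κ → ℝ} {C₀ : κ → ℝ} {δ : ℕ → κ → E} {r c : ℝ} (hr : 0 < r) (hc : 0 < c)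
    (hball : ∀ j, Metric.closedBall (θ j) r ⊆ Θ j)
    (hconv : ∀ m j, ConvexOn ℝ (Θ j) (f m j))
    (hgrad : ∀ m j, ∀ η ∈ Metric.closedBall (θ j) r, HasGradientAt (f m j) (g m j η) η)
    (hexp : ∀ m j h, ‖h‖ ≤ r →
      ‖g m j (θ j + h) - g m j (θ j) - A m j h‖ ≤ C m j * ‖h‖ ^ 2)
    (hpos : ∀ j h, c * ‖h‖ ^ 2 ≤ ⟪H j h, h⟫_ℝ)
    (hA : ∀ j, Tendsto (fun m => A m j) atTop (𝓝 (H j)))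
    (hQ : ∀ j, Tendsto (fun m => Q m j) atTop (𝓝 (H j)))
    (hC : ∀ j, Tendsto (fun m => C m j) atTop (𝓝 (C₀ j)))
    (hg : ∀ j, Tendsto (fun m => g m j (θ j)) atTop (𝓝 0))
    (hδ : ∀ m, δ m ∈ V) (hfeas : ∀ m j, θ j + δ m j ∈ Θ j)
    (hmin : ∀ m, ∀ δ' ∈ V, (∀ j, θ j + δ' j ∈ Θ j) →
      ∑ j, f m j (θ j + δ m j) ≤ ∑ j, f m j (θ j + δ' j))
    {h : κ → E} (hh : h ∈ V) :
    (fun m => ∑ j, ⟪Q m j (δ m j) + g m j (θ j), h j⟫_ℝ)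
      =o[atTop] fun m => ∑ j, ‖g m j (θ j)‖ := by
  set D : ℝ := ∑ j, (|C₀ j| + 1) with hD
  have hD0 : 0 ≤ D := Finset.sum_nonneg fun j _ => by positivity
  have hCD : ∀ᶠ m in atTop, ∀ j, C m j ≤ D := by
    refine eventually_all.2 fun j => ?_
    have h1 : C₀ j < D := by
      have h2 : |C₀ j| + 1 ≤ D := Finset.single_le_sum (f := fun j => |C₀ j| + 1)
        (fun j _ => by positivity) (Finset.mem_univ j)
      linarith [le_abs_self (C₀ j)]
    filter_upwards [(hC j).eventually_lt_const h1] with m hm using hm.le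
  -- Half of the coercivity of `H j` survives in `A m j` for large `m`. The radius is then shrunk to
  -- `r'` so that the quadratic error consumes at most half of what remains.
  set c' := c / 2 with hc'
  have hc'0 : 0 < c' := by positivity
  obtain ⟨r', hr'0, hr'r, hr'⟩ : ∃ r', 0 < r' ∧ r' ≤ r ∧ D * r' ≤ c' / 2 := by
    refine ⟨min r (c' / 2 / (D + 1)), lt_min hr (by positivity), min_le_left _ _, ?_⟩
    calc D * min r (c' / 2 / (D + 1)) ≤ (D + 1) * (c' / 2 / (D + 1)) :=
          mul_le_mul (by linarith) (min_le_right _ _) (le_min hr.le (by positivity)) (by linarith)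
      _ = c' / 2 := by field_simp
  have hb : Tendsto (fun m => ∑ j, ‖g m j (θ j)‖) atTop (𝓝 0) := by
    simpa using tendsto_finsetSum Finset.univ fun j _ => (hg j).norm
  have hsmall : ∀ᶠ m in atTop, 2 * ∑ j, ‖g m j (θ j)‖ < c' * r' := by
    have h1 : Tendsto (fun m => 2 * ∑ j, ‖g m j (θ j)‖) atTop (𝓝 0) := by
      simpa using hb.const_mul 2
    exact h1.eventually_lt_const (by positivity)
  have hposA : ∀ᶠ m in atTop, ∀ j h, c' * ‖h‖ ^ 2 ≤ ⟪A m j h, h⟫_ℝ := by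
    refine eventually_all.2 fun j => ?_
    have h1 : Tendsto (fun m => ‖A m j - H j‖) atTop (𝓝 0) := by
      simpa using ((hA j).sub_const (H j)).norm
    filter_upwards [h1.eventually_lt_const hc'0] with m hm h
    have e : ⟪A m j h, h⟫_ℝ = ⟪H j h, h⟫_ℝ + ⟪(A m j - H j) h, h⟫_ℝ := by
      rw [← inner_add_left]; simp
    have i1 := (abs_le.1 (abs_real_inner_le_norm ((A m j - H j) h) h)).1
    have i2 := mul_le_mul_of_nonneg_right ((A m j - H j).le_opNorm h) (norm_nonneg h)
    have i3 := mul_le_mul_of_nonneg_right hm.le (sq_nonneg ‖h‖)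
    rw [e]
    nlinarith [hpos j h]
  set ε : ℕ → ℝ := fun m => 2 / c' * ∑ j,
    (‖Q m j - A m j‖ + D * (2 / c' * ∑ j, ‖g m j (θ j)‖)) * ‖h j‖ with hε
  have hε0 : Tendsto ε atTop (𝓝 0) := by
    have h1 : ∀ j, Tendsto (fun m => ‖Q m j - A m j‖) atTop (𝓝 0) := fun j => by
      simpa using ((hQ j).sub (hA j)).norm
    have h2 := (tendsto_finsetSum Finset.univ fun j _ =>
      ((h1 j).add ((hb.const_mul (2 / c')).const_mul D)).mul_const ‖h j‖).const_mul (2 / c')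
    simpa using h2
  refine Asymptotics.isLittleO_iff.2 fun a ha => ?_
  filter_upwards [hCD, hsmall, hposA, hε0.eventually_lt_const ha] with m h1 h2 h3 h4
  obtain ⟨hn, hz⟩ := constrained_argmin_bound V hc'0 hr' hD0
    (fun j => (Metric.closedBall_subset_closedBall hr'r).trans (hball j)) (hconv m)
    (fun j η hη => hgrad m j η (Metric.closedBall_subset_closedBall hr'r hη))
    (fun j h hh => (hexp m j h (hh.trans hr'r)).trans
      (mul_le_mul_of_nonneg_right (h1 j) (sq_nonneg _))) h3 h2 (hδ m) (hfeas m) (hmin m)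
  set b := ∑ j, ‖g m j (θ j)‖ with hbdef
  have hb0 : 0 ≤ b := Finset.sum_nonneg fun j _ => norm_nonneg _
  have hbr : 2 / c' * b ≤ r := by
    rw [div_mul_eq_mul_div, div_le_iff₀ hc'0]; nlinarith
  -- Subtracting the exact first order condition leaves two errors: the change of operator, `o(1)`
  -- times `‖δ‖`, and the expansion remainder, `O(‖δ‖²)`. Both are `o(b)` because `‖δ m j‖ ≤ 2 / c'
  -- * b`.
  have e : ∑ j, ⟪Q m j (δ m j) + g m j (θ j), h j⟫_ℝ = ∑ j, ⟪(Q m j - A m j) (δ m j)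
      - (g m j (θ j + δ m j) - g m j (θ j) - A m j (δ m j)), h j⟫_ℝ := by
    rw [← sub_zero (∑ j, ⟪Q m j (δ m j) + g m j (θ j), h j⟫_ℝ), ← hz h hh,
      ← Finset.sum_sub_distrib]
    refine Finset.sum_congr rfl fun j _ => ?_
    rw [← inner_sub_left]
    congr 1
    simp only [sub_apply]
    abel
  rw [Real.norm_of_nonneg hb0, e]
  refine le_trans ?_ (mul_le_mul_of_nonneg_right h4.le hb0)
  refine (norm_sum_le _ _).trans ?_
  rw [hε]
  simp only
  rw [← hbdef, mul_assoc, Finset.sum_mul, Finset.mul_sum]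
  refine Finset.sum_le_sum fun j _ => ?_
  refine (norm_inner_le_norm _ _).trans ?_
  have i1 : ‖(Q m j - A m j) (δ m j)‖ ≤ ‖Q m j - A m j‖ * (2 / c' * b) :=
    ((Q m j - A m j).le_opNorm _).trans (mul_le_mul_of_nonneg_left (hn j) (norm_nonneg _))
  have i2 : ‖g m j (θ j + δ m j) - g m j (θ j) - A m j (δ m j)‖
      ≤ D * (2 / c' * b) * (2 / c' * b) := by
    refine (hexp m j _ ((hn j).trans hbr)).trans ?_
    rw [mul_assoc, ← sq]
    exact mul_le_mul (h1 j) (pow_le_pow_left₀ (norm_nonneg _) (hn j) 2) (by positivity) hD0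
  calc _ ≤ (‖Q m j - A m j‖ * (2 / c' * b) + D * (2 / c' * b) * (2 / c' * b)) * ‖h j‖ :=
        mul_le_mul_of_nonneg_right ((norm_sub_le _ _).trans (add_le_add i1 i2)) (norm_nonneg _)
    _ = _ := by ring

end Argmin

/-! ### Measurability and moments of derivatives -/

section Measurability

variable {α : Type*} [MeasurableSpace α] {μ : Measure α}

/-- The derivative of a family of functions which depend measurably on a parameter does so too. -/
theorem aestronglyMeasurable_fderiv_param {ι : Type*} [Fintype ι] {H : Type*}
    [NormedAddCommGroup H] [NormedSpace ℝ H] {f : α → EuclideanSpace ℝ ι → H}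
    {θ : EuclideanSpace ℝ ι} (hf : ∀ᶠ η in 𝓝 θ, AEStronglyMeasurable (fun x => f x η) μ)
    (hd : ∀ x, DifferentiableAt ℝ (f x) θ) :
    AEStronglyMeasurable (fun x => fderiv ℝ (f x) θ) μ := by
  classical
  have h1 : ∀ v, AEStronglyMeasurable (fun x => fderiv ℝ (f x) θ v) μ := fun v => by
    have hc : Tendsto (fun n : ℕ => (n : ℝ)) atTop atTop := tendsto_natCast_atTop_atTop
    have hθ : Tendsto (fun n : ℕ => θ + (n : ℝ)⁻¹ • v) atTop (𝓝 θ) := by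
      simpa using ((tendsto_inv_atTop_zero.comp hc).smul_const v).const_add θ
    -- Measurability is available only near `θ`, so the difference quotients start at index `n₀`.
    -- Their limits are the directional derivatives, and finitely many of these determine the
    -- derivative.
    obtain ⟨n₀, hn₀⟩ := eventually_atTop.1 (hθ.eventually hf)
    have hshift : Tendsto (fun n : ℕ => n + n₀) atTop atTop := tendsto_add_atTop_nat n₀
    refine aestronglyMeasurable_of_tendsto_ae atTop
      (f := fun n x => ((n + n₀ : ℕ) : ℝ) • (f x (θ + ((n + n₀ : ℕ) : ℝ)⁻¹ • v) - f x θ))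
      (fun n => ?_) (Eventually.of_forall fun x => ?_)
    · exact ((hn₀ (n + n₀) (Nat.le_add_left _ _)).sub hf.self_of_nhds).const_smul _
    · exact (hd x).hasFDerivAt.lim v (tendsto_norm_atTop_atTop.comp (hc.comp hshift))
  have h2 : ∀ L : EuclideanSpace ℝ ι →L[ℝ] H, L = ∑ i, ContinuousLinearMap.smulRightL ℝ _ H
      (EuclideanSpace.proj i) (L (EuclideanSpace.single i 1)) := fun L => by
    ext v
    conv_lhs => rw [← (EuclideanSpace.basisFun ι ℝ).sum_repr v, map_sum]
    simp [ContinuousLinearMap.smulRightL]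
  rw [show (fun x => fderiv ℝ (f x) θ) = fun x => ∑ i, ContinuousLinearMap.smulRightL ℝ _ H
      (EuclideanSpace.proj i) (fderiv ℝ (f x) θ (EuclideanSpace.single i 1)) from
    funext fun x => h2 _]
  refine Finset.aestronglyMeasurable_fun_sum _ fun i _ => ?_
  exact (ContinuousLinearMap.continuous _).comp_aestronglyMeasurable (h1 _)

theorem memLp_of_lintegral_rpow_le {H : Type*} [NormedAddCommGroup H] {f : α → H} {p c : ℝ}
    (hp : 0 < p) (hf : AEStronglyMeasurable f μ)
    (h : ∫⁻ x, ‖f x‖ₑ ^ p ∂μ ≤ ENNReal.ofReal c) : MemLp f (ENNReal.ofReal p) μ := by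
  refine ⟨hf, ?_⟩
  rw [eLpNorm_lt_top_iff_lintegral_rpow_enorm_lt_top (by simpa using hp) ENNReal.ofReal_ne_top,
    ENNReal.toReal_ofReal hp.le]
  exact h.trans_lt ENNReal.ofReal_lt_top

end Measurability

variable {d p₁ p₂ K : ℕ}

/-- The passage between spectral-norm assumptions on Hessian matrices and operator-norm bounds on
derivatives of gradients rests on this identity. -/
theorem fderiv_gradient_eq_hess (f : Param p₁ p₂ → ℝ) (θ : Param p₁ p₂) :
    fderiv ℝ (gradient f) θ = Matrix.toEuclideanCLM (𝕜 := ℝ) (hess f θ) := by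
  refine ContinuousLinearMap.coe_injective ((EuclideanSpace.basisFun _ ℝ).toBasis.ext fun b => ?_)
  ext a
  simp [hess, Matrix.ofLp_toEuclideanCLM]

theorem norm_hess_sub (f : Param p₁ p₂ → ℝ) (A : Matrix (Fin p₁ ⊕ Fin p₂) (Fin p₁ ⊕ Fin p₂) ℝ)
    (θ : Param p₁ p₂) :
    ‖fderiv ℝ (gradient f) θ - Matrix.toEuclideanCLM (𝕜 := ℝ) A‖ = ‖hess f θ - A‖ := by
  rw [fderiv_gradient_eq_hess, ← map_sub, Matrix.l2_opNorm_toEuclideanCLM]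

theorem fderiv_gradient_single (f : Param p₁ p₂ → ℝ) (θ : Param p₁ p₂) (a b : Fin p₁ ⊕ Fin p₂) :
    fderiv ℝ (gradient f) θ (EuclideanSpace.single b 1) a = hess f θ a b := rfl

/-- First order expansion of the gradient of a function with Lipschitz Hessian. -/
theorem norm_gradient_sub_sub_le {f : Param p₁ p₂ → ℝ} {θ : Param p₁ p₂} {r G : ℝ}
    (hd : ∀ η ∈ Metric.closedBall θ r, TwiceDifferentiableAt f η)
    (hL : ∀ η ∈ Metric.closedBall θ r, ‖hess f η - hess f θ‖ ≤ G * ‖η - θ‖)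
    {h : Param p₁ p₂} (hh : ‖h‖ ≤ r) :
    ‖gradient f (θ + h) - gradient f θ - fderiv ℝ (gradient f) θ h‖ ≤ |G| * ‖h‖ ^ 2 := by
  -- Applying the mean value inequality on the ball of radius `‖h‖` rather than `r` is what yields
  -- the second factor `‖h‖`.
  have hsub : Metric.closedBall θ ‖h‖ ⊆ Metric.closedBall θ r :=
    Metric.closedBall_subset_closedBall hh
  have := Convex.norm_image_sub_le_of_norm_fderiv_le' (𝕜 := ℝ) (f := gradient f)
    (s := Metric.closedBall θ ‖h‖) (φ := fderiv ℝ (gradient f) θ) (C := |G| * ‖h‖) (x := θ)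
    (y := θ + h) (fun η hη => (hd η (hsub hη)).2) (fun η hη => ?_) (convex_closedBall _ _)
    (by simp) (by simp)
  · rw [add_sub_cancel_left] at this
    refine this.trans (le_of_eq ?_)
    ring
  · rw [fderiv_gradient_eq_hess f θ, norm_hess_sub]
    refine (hL η (hsub hη)).trans ?_
    exact mul_le_mul (le_abs_self G) (mem_closedBall_iff_norm.1 hη) (norm_nonneg _) (abs_nonneg _)

/-! ### Regularity of one block -/

/-- The properties of a block with distribution `F` which are used in the asymptotic analysis:
the score at `θ` is centred and square integrable, the Hessian is integrable with positive definite
mean, and the gradient has an expansion at `θ` with integrable constant `|G|`. -/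
structure BlockRegular (F : Measure (Obs d)) (M : Obs d → Param p₁ p₂ → ℝ)
    (Θ : Set (Param p₁ p₂)) (θ : Param p₁ p₂) (G : Obs d → ℝ) (c r : ℝ) : Prop where
  ball_subset : Metric.closedBall θ r ⊆ Θ
  convex_obj : ∀ x, ConvexOn ℝ Θ (M x)
  differentiable : ∀ x, ∀ η ∈ Metric.closedBall θ r, DifferentiableAt ℝ (M x) η
  expansion : ∀ x h, ‖h‖ ≤ r →
    ‖gradient (M x) (θ + h) - gradient (M x) θ - fderiv ℝ (gradient (M x)) θ h‖
      ≤ |G x| * ‖h‖ ^ 2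
  memLp_score : MemLp (fun x => gradient (M x) θ) 2 F
  integral_score : ∫ x, gradient (M x) θ ∂F = 0
  integrable_hess : Integrable (fun x => fderiv ℝ (gradient (M x)) θ) F
  integral_hess : ∫ x, fderiv ℝ (gradient (M x)) θ ∂F
    = Matrix.toEuclideanCLM (𝕜 := ℝ) (popHess F M θ)
  integrable_lipschitz : Integrable (fun x => |G x|) F
  posSemidef : (popHess F M θ - c • (1 : Matrix _ _ ℝ)).PosSemidef

/-- The Lipschitz bound on the Hessians dominates gradients and Hessians near `θ` by integrable
functions, so the risk may be differentiated twice under the integral. The first derivative vanishes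
at the interior minimizer, which centres the score; the second identifies the mean Hessian with the
Hessian of the risk and so transfers the lower bound `c`. -/
theorem BlockRegular.of_assumptions {F : Measure (Obs d)} [IsProbabilityMeasure F]
    {M : Obs d → Param p₁ p₂ → ℝ} {Θ : Set (Param p₁ p₂)} {θ : Param p₁ p₂} {G : Obs d → ℝ}
    {c r v v₁ R L G₀ : ℝ} (hr : 0 < r) (hv : 2 ≤ v) (hv₁ : 2 ≤ v₁)
    (hball : Metric.closedBall θ r ⊆ Θ) (hconv : ∀ x, ConvexOn ℝ Θ (M x))
    (hint : ∀ η ∈ Θ, Integrable (fun x => M x η) F)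
    (hmin : ∀ η ∈ Θ, η ≠ θ → popRisk F M θ < popRisk F M η)
    (hpos : (hess (popRisk F M) θ - c • (1 : Matrix _ _ ℝ)).PosSemidef)
    (htwice : ∀ x, ∀ η ∈ Metric.closedBall θ r, TwiceDifferentiableAt (M x) η)
    (hscore : ∫⁻ x, ‖gradient (M x) θ‖ₑ ^ (2 * v₁) ∂F ≤ ENNReal.ofReal (R ^ (2 * v₁)))
    (hhess : ∫⁻ x, ‖hess (M x) θ - hess (popRisk F M) θ‖ₑ ^ (2 * v) ∂F
      ≤ ENNReal.ofReal (L ^ (2 * v)))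
    (hlip : ∀ x, ∀ η ∈ Metric.closedBall θ r, ∀ η' ∈ Metric.closedBall θ r,
      ‖hess (M x) η - hess (M x) η'‖ ≤ G x * ‖η - η'‖)
    (hG : Measurable G) (hGmom : ∫⁻ x, ‖G x‖ₑ ^ (2 * v) ∂F ≤ ENNReal.ofReal (G₀ ^ (2 * v))) :
    BlockRegular F M Θ θ G c r := by
  have hθ : θ ∈ Metric.closedBall θ r := Metric.mem_closedBall_self hr.le
  have hdiff : ∀ x, ∀ η ∈ Metric.closedBall θ r, DifferentiableAt ℝ (M x) η := fun x η hη =>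
    (htwice x η hη).1.self_of_nhds
  have hexp : ∀ x h, ‖h‖ ≤ r →
      ‖gradient (M x) (θ + h) - gradient (M x) θ - fderiv ℝ (gradient (M x)) θ h‖
        ≤ |G x| * ‖h‖ ^ 2 := fun x h hh =>
    norm_gradient_sub_sub_le (htwice x) (fun η hη => hlip x η hη θ hθ) hh
  -- measurability
  have hopen : ∀ η ∈ Metric.ball θ r, Metric.ball θ r ∈ 𝓝 η := fun η hη =>
    Metric.isOpen_ball.mem_nhds hη
  -- Integrability of the objective supplies the measurability of `x ↦ M x ζ`; each differentiation
  -- passes it on through difference quotients, which is why the open ball is needed.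
  have hMmeas : ∀ η ∈ Metric.ball θ r, ∀ᶠ ζ in 𝓝 η, AEStronglyMeasurable (fun x => M x ζ) F :=
    fun η hη => by
      filter_upwards [hopen η hη] with ζ hζ
      exact (hint ζ (hball (Metric.ball_subset_closedBall hζ))).aestronglyMeasurable
  have hfmeas : ∀ η ∈ Metric.ball θ r, AEStronglyMeasurable (fun x => fderiv ℝ (M x) η) F :=
    fun η hη => aestronglyMeasurable_fderiv_param (hMmeas η hη)
      fun x => hdiff x η (Metric.ball_subset_closedBall hη)
  have hgmeas : ∀ η ∈ Metric.ball θ r, AEStronglyMeasurable (fun x => gradient (M x) η) F :=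
    fun η hη => (InnerProductSpace.toDual ℝ (Param p₁ p₂)).symm.continuous.comp_aestronglyMeasurable
      (hfmeas η hη)
  have hθ' : θ ∈ Metric.ball θ r := Metric.mem_ball_self hr
  have hDmeas : AEStronglyMeasurable (fun x => fderiv ℝ (gradient (M x)) θ) F :=
    aestronglyMeasurable_fderiv_param
      (by filter_upwards [hopen θ hθ'] with η hη using hgmeas η hη) fun x => (htwice x θ hθ).2
  -- moments
  have hg2 : MemLp (fun x => gradient (M x) θ) 2 F := by
    refine (memLp_of_lintegral_rpow_le (by linarith) (hgmeas θ hθ') hscore).mono_exponent ?_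
    rw [← ENNReal.ofReal_ofNat]
    exact ENNReal.ofReal_le_ofReal (by linarith)
  have hgint := hg2.integrable (by norm_num)
  have hv1 : (1 : ENNReal) ≤ ENNReal.ofReal (2 * v) := by
    rw [← ENNReal.ofReal_one]
    exact ENNReal.ofReal_le_ofReal (by linarith)
  have hDint : Integrable (fun x => fderiv ℝ (gradient (M x)) θ) F := by
    have h1 : MemLp (fun x => fderiv ℝ (gradient (M x)) θ
        - Matrix.toEuclideanCLM (𝕜 := ℝ) (hess (popRisk F M) θ)) (ENNReal.ofReal (2 * v)) F := by
      refine memLp_of_lintegral_rpow_le (c := L ^ (2 * v)) (by linarith)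
        (hDmeas.sub aestronglyMeasurable_const) ?_
      refine le_trans (le_of_eq ?_) hhess
      refine lintegral_congr fun x => ?_
      rw [← enorm_norm (fderiv ℝ _ _ - _), norm_hess_sub, enorm_norm]
    have h2 := (h1.integrable hv1).add
      (integrable_const (Matrix.toEuclideanCLM (𝕜 := ℝ) (hess (popRisk F M) θ)))
    refine h2.congr (Eventually.of_forall fun x => ?_)
    simp
  have hGint : Integrable (fun x => |G x|) F :=
    ((memLp_of_lintegral_rpow_le (by linarith) hG.aestronglyMeasurable hGmom).integrable hv1).abs
  -- first derivative of the population risk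
  set bound₁ : Obs d → ℝ := fun x =>
    ‖gradient (M x) θ‖ + (‖fderiv ℝ (gradient (M x)) θ‖ * r + |G x| * r ^ 2) with hbound₁
  have hbound₁int : Integrable bound₁ F :=
    hgint.norm.add ((hDint.norm.mul_const r).add (hGint.mul_const (r ^ 2)))
  have hgbound : ∀ x, ∀ η ∈ Metric.closedBall θ r, ‖gradient (M x) η‖ ≤ bound₁ x := by
    intro x η hη
    have hηr : ‖η - θ‖ ≤ r := mem_closedBall_iff_norm.1 hη
    have h1 := hexp x (η - θ) hηr
    rw [add_sub_cancel] at h1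
    have h2 : gradient (M x) η = gradient (M x) θ + (fderiv ℝ (gradient (M x)) θ (η - θ)
        + (gradient (M x) η - gradient (M x) θ - fderiv ℝ (gradient (M x)) θ (η - θ))) := by abel
    rw [h2]
    refine (norm_add_le _ _).trans (add_le_add le_rfl ((norm_add_le _ _).trans
      (add_le_add ?_ (h1.trans ?_))))
    · exact ((fderiv ℝ (gradient (M x)) θ).le_opNorm _).trans
        (mul_le_mul_of_nonneg_left hηr (norm_nonneg _))
    · exact mul_le_mul_of_nonneg_left (pow_le_pow_left₀ (norm_nonneg _) hηr 2) (abs_nonneg _)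
  have hfnorm : ∀ x η, ‖fderiv ℝ (M x) η‖ = ‖gradient (M x) η‖ := fun x η => by
    rw [← toDual_gradient, LinearIsometryEquiv.norm_map]
  have hfint : ∀ η ∈ Metric.ball θ r, Integrable (fun x => fderiv ℝ (M x) η) F := fun η hη =>
    hbound₁int.mono' (hfmeas η hη) (Eventually.of_forall fun x =>
      (hfnorm x η).trans_le (hgbound x η (Metric.ball_subset_closedBall hη)))
  have hgint' : ∀ η ∈ Metric.ball θ r, Integrable (fun x => gradient (M x) η) F := fun η hη =>
    hbound₁int.mono' (hgmeas η hη) (Eventually.of_forall fun x =>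
      hgbound x η (Metric.ball_subset_closedBall hη))
  have hrisk : ∀ η ∈ Metric.ball θ r, HasFDerivAt (popRisk F M) (∫ x, fderiv ℝ (M x) η ∂F) η := by
    intro η hη
    refine hasFDerivAt_integral_of_dominated_of_fderiv_le (F := fun ζ x => M x ζ)
      (F' := fun ζ x => fderiv ℝ (M x) ζ) (bound := bound₁) (hopen η hη) (hMmeas η hη)
      (hint η (hball (Metric.ball_subset_closedBall hη))) (hfmeas η hη) ?_ hbound₁int ?_
    · exact Eventually.of_forall fun x ζ hζ =>
        (hfnorm x ζ).trans_le (hgbound x ζ (Metric.ball_subset_closedBall hζ))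
    · exact Eventually.of_forall fun x ζ hζ =>
        (hdiff x ζ (Metric.ball_subset_closedBall hζ)).hasFDerivAt
  have hgrisk : ∀ η ∈ Metric.ball θ r, gradient (popRisk F M) η = ∫ x, gradient (M x) η ∂F := by
    intro η hη
    refine ext_inner_left ℝ fun w => ?_
    rw [real_inner_comm, inner_gradient_left, (hrisk η hη).fderiv,
      ContinuousLinearMap.integral_apply (hfint η hη), ← integral_inner (hgint' η hη)]
    refine integral_congr_ae (Eventually.of_forall fun x => ?_)
    simp only
    rw [real_inner_comm, inner_gradient_left]
  have hmean : ∫ x, gradient (M x) θ ∂F = 0 := by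
    rw [← hgrisk θ hθ', gradient, IsLocalMin.fderiv_eq_zero, map_zero]
    filter_upwards [hopen θ hθ'] with η hη
    by_cases h : η = θ
    · rw [h]
    · exact (hmin η (hball (Metric.ball_subset_closedBall hη)) h).le
  -- second derivative of the population risk
  have hD : HasFDerivAt (fun η => ∫ x, gradient (M x) η ∂F)
      (∫ x, fderiv ℝ (gradient (M x)) θ ∂F) θ := by
    refine hasFDerivAt_integral_of_dominated_of_fderiv_le (F := fun ζ x => gradient (M x) ζ)
      (F' := fun ζ x => fderiv ℝ (gradient (M x)) ζ)
      (bound := fun x => ‖fderiv ℝ (gradient (M x)) θ‖ + |G x| * r) (hopen θ hθ')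
      (by filter_upwards [hopen θ hθ'] with η hη using hgmeas η hη) hgint hDmeas
      (Eventually.of_forall fun x η hη => ?_) (hDint.norm.add (hGint.mul_const r))
      (Eventually.of_forall fun x η hη =>
        (htwice x η (Metric.ball_subset_closedBall hη)).2.hasFDerivAt)
    have hη' := Metric.ball_subset_closedBall hη
    have h1 : ‖fderiv ℝ (gradient (M x)) η - fderiv ℝ (gradient (M x)) θ‖ ≤ |G x| * r := by
      rw [fderiv_gradient_eq_hess (M x) θ, norm_hess_sub]
      exact (hlip x η hη' θ hθ).trans (mul_le_mul (le_abs_self _) (mem_closedBall_iff_norm.1 hη')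
        (norm_nonneg _) (abs_nonneg _))
    calc _ = ‖fderiv ℝ (gradient (M x)) θ
          + (fderiv ℝ (gradient (M x)) η - fderiv ℝ (gradient (M x)) θ)‖ := by
          rw [add_sub_cancel]
      _ ≤ _ := (norm_add_le _ _).trans (add_le_add le_rfl h1)
  have hD' : fderiv ℝ (gradient (popRisk F M)) θ = ∫ x, fderiv ℝ (gradient (M x)) θ ∂F := by
    refine (hD.congr_of_eventuallyEq ?_).fderiv
    filter_upwards [hopen θ hθ'] with η hη using hgrisk η hη
  have hpop : popHess F M θ = hess (popRisk F M) θ := by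
    ext a b
    rw [← fderiv_gradient_single, hD', ContinuousLinearMap.integral_apply hDint]
    exact ((EuclideanSpace.proj (𝕜 := ℝ) a).integral_comp_comm
      (hDint.apply_continuousLinearMap _))
  exact ⟨hball, hconv, hdiff, hexp, hg2, hmean, hDint,
    by rw [← hD', hpop, fderiv_gradient_eq_hess], hGint, by rwa [hpop]⟩

/-- All blocks of the model are regular, with common constants. -/
theorem Model.blockRegular {M : Obs d → Param p₁ p₂ → ℝ} {F : Fin K → Measure (Obs d)}
    {Θ : Fin K → Set (Param p₁ p₂)} {φs : EuclideanSpace ℝ (Fin p₁)}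
    {ls : Fin K → EuclideanSpace ℝ (Fin p₂)} {v v₁ : ℝ} (hv : 2 ≤ v) (hv₁ : 2 ≤ v₁)
    (h : Model M F Θ φs ls v v₁) :
    ∃ (G : Obs d → ℝ) (c r : ℝ), 0 < c ∧ 0 < r ∧
      ∀ k, BlockRegular (F k) M (Θ k) (join φs (ls k)) G c r := by
  obtain ⟨c, hc, hc'⟩ := h.strong_convexity
  obtain ⟨R, L, G₀, B₀, ρ, G, B, -, -, -, -, hρ, hG, -, hS⟩ := h.smoothness
  have hev : ∀ k, ∀ᶠ r in 𝓝[>] (0 : ℝ), Metric.closedBall (join φs (ls k)) r ⊆ Θ k := fun k => by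
    obtain ⟨ε, hε, hsub⟩ := Metric.nhds_basis_closedBall.mem_iff.1
      (mem_interior_iff_mem_nhds.1 (h.compactness.interior k))
    filter_upwards [Ioc_mem_nhdsGT hε] with r hr
    exact (Metric.closedBall_subset_closedBall hr.2).trans hsub
  obtain ⟨r, hr, hr0, hrρ⟩ := ((eventually_all.2 hev).and (Ioc_mem_nhdsGT hρ)).exists
  refine ⟨G, c, r, hc, hr0, fun k => ?_⟩
  have := h.prob k
  obtain ⟨h1, h2, h3, h4, h5, -⟩ := hS k
  have hsub : Metric.closedBall (join φs (ls k)) r ⊆ Metric.closedBall (join φs (ls k)) ρ :=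
    Metric.closedBall_subset_closedBall hrρ
  exact .of_assumptions hr0 hv hv₁ (hr k) (h.convex_obj k) (h.identifiability.integrable k)
    (h.identifiability.unique_min k) (hc' k).2 (fun x η hη => h1 x η (hsub hη)) h2 h3
    (fun x η hη η' hη' => (h4 x η (hsub hη) η' (hsub hη')).1) hG h5

/-! ### Convergence in probability and in distribution -/

section Convergence

variable {Ω : Type*} [MeasurableSpace Ω] {P : Measure Ω}

/-- The product of a sequence which tends to zero in probability and a sequence which is bounded
in `L¹` tends to zero in probability. -/
theorem tendstoInMeasure_mul_of_integral_le {η Z : ℕ → Ω → ℝ} {C : ℝ}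
    (hη : TendstoInMeasure P η atTop 0) (hZ : ∀ m, Integrable (Z m) P) (hZ0 : ∀ m ω, 0 ≤ Z m ω)
    (hC : ∀ m, ∫ ω, Z m ω ∂P ≤ C) :
    TendstoInMeasure P (fun m ω => η m ω * Z m ω) atTop 0 := by
  rw [tendstoInMeasure_iff_norm] at hη ⊢
  intro ε hε
  refine ENNReal.tendsto_nhds_zero.2 fun a ha => ?_
  by_cases hatop : a = ⊤
  · simp [hatop]
  have ha' : 0 < a.toReal := ENNReal.toReal_pos ha.ne' hatop
  -- With this truncation level Markov's inequality gives `P (Z m ≥ T) ≤ a / 2` uniformly in `m`;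
  -- where `Z m < T` the product is controlled by `T * η m`.
  set T : ℝ := 2 * (|C| + 1) / a.toReal with hT
  have hT0 : 0 < T := by positivity
  have h1 : ∀ m, P {ω | ENNReal.ofReal T ≤ ENNReal.ofReal (Z m ω)} ≤ a / 2 := fun m => by
    refine (meas_ge_le_lintegral_div (hZ m).1.aemeasurable.ennreal_ofReal
      (by simpa using hT0) ENNReal.ofReal_ne_top).trans ?_
    rw [← ofReal_integral_eq_lintegral_ofReal (hZ m) (Eventually.of_forall (hZ0 m)),
      ← ENNReal.ofReal_div_of_pos hT0]
    have e : a / 2 = ENNReal.ofReal (a.toReal / 2) := by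
      rw [ENNReal.ofReal_div_of_pos two_pos, ENNReal.ofReal_toReal hatop, ENNReal.ofReal_ofNat]
    rw [e]
    refine ENNReal.ofReal_le_ofReal ?_
    rw [div_le_iff₀ hT0, hT]
    have : a.toReal / 2 * (2 * (|C| + 1) / a.toReal) = |C| + 1 := by field_simp
    rw [this]
    linarith [hC m, le_abs_self C]
  have h2 := ENNReal.tendsto_nhds_zero.1 (hη (ε / T) (by positivity)) (a / 2)
    (ENNReal.half_pos ha.ne')
  filter_upwards [h2] with m hm
  calc P {ω | ε ≤ ‖η m ω * Z m ω - (0 : Ω → ℝ) ω‖}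
      ≤ P ({ω | ε / T ≤ ‖η m ω - (0 : Ω → ℝ) ω‖} ∪
          {ω | ENNReal.ofReal T ≤ ENNReal.ofReal (Z m ω)}) := by
        refine measure_mono fun ω hω => ?_
        by_contra hcon
        simp only [Pi.zero_apply, sub_zero, Set.mem_union, Set.mem_ofPred_eq, not_or, not_le]
          at hω hcon
        have hZT : Z m ω < T := (ENNReal.ofReal_lt_ofReal_iff hT0).1 hcon.2
        rw [norm_mul, Real.norm_of_nonneg (hZ0 m ω)] at hω
        have h3 : ‖η m ω‖ * Z m ω ≤ ‖η m ω‖ * T :=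
          mul_le_mul_of_nonneg_left hZT.le (norm_nonneg _)
        have h4 := (lt_div_iff₀ hT0).1 hcon.1
        linarith
    _ ≤ a / 2 + a / 2 := (measure_union_le _ _).trans (add_le_add hm (h1 m))
    _ = a := ENNReal.add_halves a

/-- The analytic core of the Cramér–Wold device: one-dimensional projections determine the
characteristic function of a vector. -/
theorem charFun_map_inner {E : Type*} [NormedAddCommGroup E] [InnerProductSpace ℝ E]
    [MeasurableSpace E] [BorelSpace E] [SecondCountableTopology E] {S : Ω → E}
    (hS : AEMeasurable S P) (v : E) :
    charFun (P.map S) v = charFun (P.map fun ω => ⟪S ω, v⟫_ℝ) 1 := by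
  rw [charFun_apply, charFun_apply, integral_map hS, integral_map]
  · simp
  · exact (continuous_id.inner continuous_const).measurable.comp_aemeasurable hS
  · exact Measurable.aestronglyMeasurable (by fun_prop)
  · exact Measurable.aestronglyMeasurable (by fun_prop)

variable [IsProbabilityMeasure P]

/-- Cramér–Wold device for a Gaussian limit. -/
theorem tendstoInDistribution_multivariateGaussian {p : ℕ}
    {S : ℕ → Ω → EuclideanSpace ℝ (Fin p)} {C : Matrix (Fin p) (Fin p) ℝ} (hC : C.PosSemidef)
    (hS : ∀ m, AEMeasurable (S m) P)
    (h : ∀ v : EuclideanSpace ℝ (Fin p), TendstoInDistribution (fun m ω => ⟪S m ω, v⟫_ℝ) atTop id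
      (fun _ => P) (gaussianReal 0 (v ⬝ᵥ C.mulVec v).toNNReal)) :
    TendstoInDistribution S atTop id (fun _ => P) (multivariateGaussian 0 C) where
  forall_aemeasurable := hS
  tendsto := by
    refine ProbabilityMeasure.tendsto_iff_tendsto_charFun.2 fun v => ?_
    have h1 := ProbabilityMeasure.tendsto_iff_tendsto_charFun.1 (h v).tendsto 1
    simp only [ProbabilityMeasure.coe_mk, Measure.map_id] at h1 ⊢
    have h2 : 0 ≤ v ⬝ᵥ C.mulVec v := by simpa using hC.dotProduct_mulVec_nonneg v
    rw [charFun_gaussianReal, Real.coe_toNNReal _ h2] at h1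
    rw [charFun_multivariateGaussian hC]
    simp_rw [charFun_map_inner (hS _)]
    convert h1 using 2
    simp

end Convergence

/-! ### Sample sizes -/

/-- The total sample size. -/
abbrev total (n : ℕ → Fin K → ℕ) (m : ℕ) : ℝ := ((∑ k, n m k : ℕ) : ℝ)

section SampleSizes

variable {n : ℕ → Fin K → ℕ} {γ : Fin K → ℝ}

theorem SampleSizes.tendsto_total (hn : SampleSizes n γ) : Tendsto (total n) atTop atTop :=
  tendsto_natCast_atTop_atTop.comp hn.total_tendsto

/-- `n_k = (n_k / N) * N`, where the ratio has a positive limit and `N` tends to infinity. -/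
theorem SampleSizes.tendsto_size (hn : SampleSizes n γ) (k : Fin K) :
    Tendsto (fun m => n m k) atTop atTop := by
  refine tendsto_natCast_atTop_iff (R := ℝ) |>.1 ?_
  have h := (hn.ratio_tendsto k).pos_mul_atTop (hn.limit_pos k) hn.tendsto_total
  refine h.congr' ?_
  filter_upwards [hn.tendsto_total.eventually_gt_atTop 0] with m hm
  exact div_mul_cancel₀ _ hm.ne'

end SampleSizes

/-! ### Limit theorems for the sample -/

section Sample

variable {Ω : Type*} [MeasurableSpace Ω] {P : Measure Ω} {X : Fin K → ℕ → Ω → Obs d}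
  {F : Fin K → Measure (Obs d)} {n : ℕ → Fin K → ℕ} {γ : Fin K → ℝ}

theorem IsSample.aemeasurable_comp (hX : IsSample P X F) {B : Type*} [MeasurableSpace B]
    {f : Obs d → B} (k : Fin K) (hf : AEMeasurable f (F k)) (i : ℕ) :
    AEMeasurable (fun ω => f (X k i ω)) P :=
  ((hX.law k i).map_eq ▸ hf).comp_aemeasurable (hX.law k i).aemeasurable

theorem IsSample.iIndepFun_comp (hX : IsSample P X F) {B : Type*} [MeasurableSpace B]
    {f : Fin K → Obs d → B} (hf : ∀ k, AEMeasurable (f k) (F k)) :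
    iIndepFun (fun (q : Fin K × ℕ) ω => f q.1 (X q.1 q.2 ω)) P :=
  hX.indep.comp₀ (fun q => f q.1) (fun q => (hX.law q.1 q.2).aemeasurable)
    fun q => by rw [(hX.law q.1 q.2).map_eq]; exact hf q.1

theorem IsSample.iIndepFun_block (hX : IsSample P X F) {B : Type*} [MeasurableSpace B]
    {f : Obs d → B} (k : Fin K) (hf : AEMeasurable f (F k)) :
    iIndepFun (fun (i : ℕ) ω => f (X k i ω)) P :=
  (hX.indep.precomp (g := fun i : ℕ => (k, i)) fun i j h => (Prod.mk.inj h).2).comp₀ (fun _ => f)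
    (fun i => (hX.law k i).aemeasurable) fun i => by rw [(hX.law k i).map_eq]; exact hf

theorem IsSample.identDistrib (hX : IsSample P X F) {B : Type*} [MeasurableSpace B]
    {f : Obs d → B} (k : Fin K) (hf : AEMeasurable f (F k)) (i : ℕ) :
    IdentDistrib (fun ω => f (X k i ω)) (fun ω => f (X k 0 ω)) P P :=
  ((hX.law k i).identDistrib (hX.law k 0)).comp_of_aemeasurable (by rwa [(hX.law k i).map_eq])

theorem IsSample.memLp (hX : IsSample P X F) {B : Type*} [NormedAddCommGroup B] {f : Obs d → B}
    {p : ENNReal} (k : Fin K) (hf : MemLp f p (F k)) (i : ℕ) :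
    MemLp (fun ω => f (X k i ω)) p P :=
  ((hX.law k i).map_eq ▸ hf).comp_of_map (hX.law k i).aemeasurable

/-- The strong law of large numbers for block `k`, normalized by the total sample size. -/
theorem IsSample.strong_law (hX : IsSample P X F) (hn : SampleSizes n γ) {B : Type*}
    [NormedAddCommGroup B] [NormedSpace ℝ B] [CompleteSpace B] [MeasurableSpace B] [BorelSpace B]
    {f : Obs d → B} (k : Fin K) (hf : Integrable f (F k)) :
    ∀ᵐ ω ∂P, Tendsto (fun m => (total n m)⁻¹ • ∑ i ∈ Finset.range (n m k), f (X k i ω)) atTop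
      (𝓝 (γ k • ∫ x, f x ∂F k)) := by
  have hmeas := hf.aestronglyMeasurable.aemeasurable
  have h1 := strong_law_ae (μ := P) (fun i ω => f (X k i ω))
    (memLp_one_iff_integrable.1 (hX.memLp k (memLp_one_iff_integrable.2 hf) 0))
    (fun i j hij => (hX.iIndepFun_block k hmeas).indepFun hij) (hX.identDistrib k hmeas)
  have h2 : ∫ ω, f (X k 0 ω) ∂P = ∫ x, f x ∂F k :=
    (hX.law k 0).integral_comp hf.aestronglyMeasurable
  filter_upwards [h1] with ω hω
  rw [h2] at hω
  refine ((hn.ratio_tendsto k).smul (hω.comp (hn.tendsto_size k))).congr' ?_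
  filter_upwards [(hn.tendsto_size k).eventually_gt_atTop 0] with m hm
  have : (n m k : ℝ) ≠ 0 := by positivity
  rw [Function.comp_apply, smul_smul]
  congr 1
  field_simp

variable [IsProbabilityMeasure P]

/-- Normalized sums of centred observations are bounded in `L²`. -/
theorem IsSample.integral_sq_le (hX : IsSample P X F) {f : Obs d → ℝ} (k : Fin K)
    (hf : MemLp f 2 (F k)) (hmean : ∫ x, f x ∂F k = 0) (m : ℕ) :
    Integrable (fun ω => ((√(total n m))⁻¹ * ∑ i ∈ Finset.range (n m k), f (X k i ω)) ^ 2) P ∧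
      ∫ ω, ((√(total n m))⁻¹ * ∑ i ∈ Finset.range (n m k), f (X k i ω)) ^ 2 ∂P
        ≤ ∫ x, f x ^ 2 ∂F k := by
  have hmeas := hf.1.aemeasurable
  have hL : ∀ i, MemLp (fun ω => f (X k i ω)) 2 P := hX.memLp k hf
  have hsum : MemLp (∑ i ∈ Finset.range (n m k), fun ω => f (X k i ω)) 2 P :=
    memLp_finsetSum' _ fun i _ => hL i
  have hint : ∀ i, ∫ ω, f (X k i ω) ∂P = 0 := fun i => by
    rw [← hmean]; exact (hX.law k i).integral_comp hf.1
  have hvar : ∀ i, Var[fun ω => f (X k i ω); P] = ∫ x, f x ^ 2 ∂F k := fun i => by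
    rw [variance_of_integral_eq_zero (hL i).1.aemeasurable (hint i)]
    exact (hX.law k i).integral_comp (f := fun x => f x ^ 2) (hf.1.pow 2)
  have h1 : ∫ ω, (∑ i ∈ Finset.range (n m k), f (X k i ω)) ^ 2 ∂P
      = n m k * ∫ x, f x ^ 2 ∂F k := by
    have h2 := IndepFun.variance_sum (μ := P) (X := fun i ω => f (X k i ω))
      (s := Finset.range (n m k)) (fun i _ => hL i)
      (fun i _ j _ hij => (hX.iIndepFun_block k hmeas).indepFun hij)
    rw [variance_of_integral_eq_zero hsum.1.aemeasurable] at h2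
    · simpa [hvar] using h2
    · simp only [Finset.sum_apply]
      rw [integral_finsetSum _ fun i _ => (hL i).integrable (by norm_num)]
      simp [hint]
  have h3 : 0 ≤ ∫ x, f x ^ 2 ∂F k := integral_nonneg fun x => sq_nonneg _
  simp_rw [mul_pow]
  refine ⟨?_, ?_⟩
  · have := hsum.integrable_sq.const_mul (((√(total n m))⁻¹) ^ 2)
    simpa using this
  · rw [integral_const_mul, h1, inv_pow, Real.sq_sqrt (by positivity), ← mul_assoc]
    -- The factor is `n_k / N ≤ 1`; the convention `0 / 0 = 0` covers `N = 0`.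
    refine mul_le_of_le_one_left h3 ?_
    rw [inv_mul_eq_div]
    refine div_le_one_of_le₀ ?_ (by positivity)
    exact_mod_cast Finset.single_le_sum (f := fun k => n m k) (fun _ _ => Nat.zero_le _)
      (Finset.mem_univ k)

/-- The central limit theorem for block `k`, normalized by the total sample size. -/
theorem IsSample.tendsto_charFun_block (hX : IsSample P X F) (hn : SampleSizes n γ)
    {f : Obs d → ℝ} (k : Fin K) (hf : MemLp f 2 (F k)) (hmean : ∫ x, f x ∂F k = 0) (t : ℝ) :
    Tendsto (fun m => charFun (P.map fun ω => f (X k 0 ω)) ((√(total n m))⁻¹ * t) ^ n m k) atTop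
      (𝓝 (Complex.exp (-((γ k * Var[f; F k] : ℝ) * t ^ 2 / 2)))) := by
  have hmeas := hf.1.aemeasurable
  have hint : ∫ ω, f (X k 0 ω) ∂P = 0 := by
    rw [← hmean]; exact (hX.law k 0).integral_comp hf.1
  have hvar : Var[fun ω => f (X k 0 ω); P] = Var[f; F k] := by
    have := variance_map (X := f) (Y := X k 0) (μ := P) ((hX.law k 0).map_eq ▸ hmeas)
      (hX.law k 0).aemeasurable
    rw [(hX.law k 0).map_eq] at this
    exact this.symm
  have h1 := tendstoInDistribution_inv_sqrt_mul_sum_sub (P := P) (X := fun i ω => f (X k i ω))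
    (P' := gaussianReal 0 Var[fun ω => f (X k 0 ω); P].toNNReal) HasLaw.id
    (hX.memLp k hf 0) (hX.iIndepFun_block k hmeas) (hX.identDistrib k hmeas)
  simp only [hint, mul_zero, sub_zero] at h1
  have h2 : TendstoInDistribution (fun m ω => (√(n m k : ℝ))⁻¹ *
      ∑ i ∈ Finset.range (n m k), f (X k i ω)) atTop id (fun _ => P)
      (gaussianReal 0 Var[fun ω => f (X k 0 ω); P].toNNReal) :=
    ⟨fun m => h1.forall_aemeasurable _, h1.aemeasurable_limit,
      h1.tendsto.comp (hn.tendsto_size k)⟩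
  -- Slutsky's theorem with this deterministic factor replaces the normalization `√n_k` by `√N` and
  -- brings `γ k` into the limiting variance.
  have h3 : TendstoInMeasure P (fun m (_ : Ω) => √((n m k : ℝ) / total n m)) atTop
      (fun _ => √(γ k)) :=
    tendstoInMeasure_of_tendsto_ae (fun m => aestronglyMeasurable_const)
      (Eventually.of_forall fun ω => (hn.ratio_tendsto k).sqrt)
  have h4 := h2.continuous_comp_prodMk_of_tendstoInMeasure_const
    (g := fun x : ℝ × ℝ => x.2 * x.1) (by fun_prop) h3 (fun m => aemeasurable_const)
  have h5 := ProbabilityMeasure.tendsto_iff_tendsto_charFun.1 h4.tendsto t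
  simp only [ProbabilityMeasure.coe_mk, id_eq] at h5
  have hlim : charFun ((gaussianReal 0 Var[fun ω => f (X k 0 ω); P].toNNReal).map
      fun ω => √(γ k) * ω) t = Complex.exp (-((γ k * Var[f; F k] : ℝ) * t ^ 2 / 2)) := by
    rw [charFun_map_mul_comp (f := fun ω => ω) aemeasurable_id, show (fun ω : ℝ => ω) = id from rfl,
      Measure.map_id, charFun_gaussianReal, hvar, Real.coe_toNNReal _ (variance_nonneg _ _)]
    congr 1
    have e : (((√(γ k) * t : ℝ) : ℂ)) ^ 2 = (γ k : ℂ) * t ^ 2 := by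
      rw [← Complex.ofReal_pow, mul_pow, Real.sq_sqrt (hn.limit_pos k).le]; push_cast; ring
    rw [e]
    push_cast
    ring
  rw [hlim] at h5
  refine h5.congr' ?_
  filter_upwards [(hn.tendsto_size k).eventually_gt_atTop 0] with m hm
  have hm' : √(n m k : ℝ) ≠ 0 := (Real.sqrt_pos.2 (by exact_mod_cast hm)).ne'
  rw [charFun_map_mul_comp (h2.forall_aemeasurable m),
    charFun_inv_sqrt_mul_sum (hX.iIndepFun_block k hmeas) (hX.identDistrib k hmeas)]
  congr 2
  rw [Real.sqrt_div (by positivity)]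
  field_simp

/-- The central limit theorem for the sum over all blocks. -/
theorem IsSample.tendstoInDistribution_sum (hX : IsSample P X F) (hn : SampleSizes n γ)
    {f : Fin K → Obs d → ℝ} (hf : ∀ k, MemLp (f k) 2 (F k))
    (hmean : ∀ k, ∫ x, f k x ∂F k = 0) :
    TendstoInDistribution (fun m ω => (√(total n m))⁻¹ *
      ∑ k, ∑ i ∈ Finset.range (n m k), f k (X k i ω)) atTop id (fun _ => P)
      (gaussianReal 0 (∑ k, γ k * Var[f k; F k]).toNNReal) := by
  have hmeas := fun k => (hf k).1.aemeasurable
  have hsum : ∀ m, AEMeasurable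
      (fun ω => ∑ k, ∑ i ∈ Finset.range (n m k), f k (X k i ω)) P := fun m =>
    Finset.aemeasurable_fun_sum _ fun k _ => Finset.aemeasurable_fun_sum _ fun i _ =>
      hX.aemeasurable_comp k (hmeas k) i
  refine ⟨fun m => (hsum m).const_mul _, aemeasurable_id, ?_⟩
  refine ProbabilityMeasure.tendsto_iff_tendsto_charFun.2 fun t => ?_
  simp only [ProbabilityMeasure.coe_mk, Measure.map_id]
  have h1 : 0 ≤ ∑ k, γ k * Var[f k; F k] :=
    Finset.sum_nonneg fun k _ => mul_nonneg (hn.limit_pos k).le (variance_nonneg _ _)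
  have h2 : charFun (gaussianReal 0 (∑ k, γ k * Var[f k; F k]).toNNReal) t
      = ∏ k, Complex.exp (-((γ k * Var[f k; F k] : ℝ) * t ^ 2 / 2)) := by
    rw [charFun_gaussianReal, Real.coe_toNNReal _ h1, ← Complex.exp_sum]
    congr 1
    rw [Finset.sum_neg_distrib, ← Finset.sum_div, ← Finset.sum_mul]
    push_cast
    ring
  rw [h2]
  -- By independence of all `X_{k,i}`, the characteristic function of the double sum is the product
  -- over `k` of the `n_k`-th powers handled blockwise, so the block limits multiply.
  refine (tendsto_finsetProd Finset.univ fun k _ =>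
    hX.tendsto_charFun_block hn k (hf k) (hmean k) t).congr fun m => ?_
  rw [charFun_map_mul_comp (hsum m)]
  have hind : iIndepFun (fun (q : (_ : Fin K) × ℕ) ω => f q.1 (X q.1 q.2 ω)) P :=
    (hX.iIndepFun_comp hmeas).precomp (Equiv.sigmaEquivProd (Fin K) ℕ).injective
  have h3 := (hind.restrict (Finset.univ.sigma fun k => Finset.range (n m k)))
    |>.charFun_map_fun_finsetSum_eq_prod fun q _ => hX.aemeasurable_comp q.1 (hmeas q.1) q.2
  simp_rw [Finset.sum_sigma] at h3
  rw [h3, Finset.prod_sigma, Finset.prod_apply]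
  refine Finset.prod_congr rfl fun k _ => ?_
  rw [Finset.prod_apply]
  simp only [(hX.identDistrib k (hmeas k) _).map_eq, Finset.prod_const, Finset.card_range]

end Sample

/-! ### Linearization of the estimators -/

theorem inner_toEuclideanCLM {ι : Type*} [Fintype ι] [DecidableEq ι] (A : Matrix ι ι ℝ)
    (x y : EuclideanSpace ℝ ι) :
    ⟪Matrix.toEuclideanCLM (𝕜 := ℝ) A x, y⟫_ℝ = y ⬝ᵥ A.mulVec x := by
  rw [EuclideanSpace.inner_eq_star_dotProduct, Matrix.ofLp_toEuclideanCLM]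
  simp

theorem BlockRegular.inner_popHess_ge {F : Measure (Obs d)} {M : Obs d → Param p₁ p₂ → ℝ}
    {Θ : Set (Param p₁ p₂)} {θ : Param p₁ p₂} {G : Obs d → ℝ} {c r : ℝ}
    (hreg : BlockRegular F M Θ θ G c r) (h : Param p₁ p₂) :
    c * ‖h‖ ^ 2 ≤ ⟪Matrix.toEuclideanCLM (𝕜 := ℝ) (popHess F M θ) h, h⟫_ℝ := by
  have h1 := hreg.posSemidef.dotProduct_mulVec_nonneg h
  rw [inner_toEuclideanCLM]
  simp only [star_trivial, Matrix.sub_mulVec, Matrix.smul_mulVec, Matrix.one_mulVec,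
    dotProduct_sub, dotProduct_smul, smul_eq_mul] at h1
  have h2 : h.ofLp ⬝ᵥ h.ofLp = ‖h‖ ^ 2 := by
    rw [EuclideanSpace.real_norm_sq_eq, dotProduct]
    exact Finset.sum_congr rfl fun i _ => (sq _).symm
  rw [h2] at h1
  linarith

section Linearization

variable {Ω : Type*} [MeasurableSpace Ω] {P : Measure Ω}
  {X : Fin K → ℕ → Ω → Obs d} {F : Fin K → Measure (Obs d)} {M : Obs d → Param p₁ p₂ → ℝ}
  {Θ : Fin K → Set (Param p₁ p₂)} {θ : Fin K → Param p₁ p₂} {n : ℕ → Fin K → ℕ} {γ : Fin K → ℝ}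
  {G : Obs d → ℝ} {c r : ℝ} [∀ k, IsProbabilityMeasure (F k)]

/-- Almost surely, a minimizer of the pooled empirical objective over the displacements in a
subspace satisfies the linearized first order condition. -/
theorem ae_isLittleO_argmin (hr : 0 < r) (hc : 0 < c)
    (hreg : ∀ k, BlockRegular (F k) M (Θ k) (θ k) G c r) (hn : SampleSizes n γ)
    (hX : IsSample P X F) {q : ℕ → Fin K → ℝ}
    (hq : ∀ k, Tendsto (fun m => q m k) atTop (𝓝 (γ k)))
    (V : Submodule ℝ (Fin K → Param p₁ p₂)) {δ : ℕ → Ω → Fin K → Param p₁ p₂}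
    (hδ : ∀ m, ∀ᵐ ω ∂P, δ m ω ∈ V ∧ (∀ k, θ k + δ m ω k ∈ Θ k) ∧
      ∀ δ' ∈ V, (∀ k, θ k + δ' k ∈ Θ k) →
        ∑ k, empObj M (fun i => X k i ω) (n m k) (θ k + δ m ω k)
          ≤ ∑ k, empObj M (fun i => X k i ω) (n m k) (θ k + δ' k))
    {h : Fin K → Param p₁ p₂} (hh : h ∈ V) :
    ∀ᵐ ω ∂P, (fun m => ∑ k,
        ⟪q m k • Matrix.toEuclideanCLM (𝕜 := ℝ) (popHess (F k) M (θ k)) (δ m ω k)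
          + (total n m)⁻¹ • ∑ i ∈ Finset.range (n m k), gradient (M (X k i ω)) (θ k), h k⟫_ℝ)
      =o[atTop] fun m => ∑ k,
        ‖(total n m)⁻¹ • ∑ i ∈ Finset.range (n m k), gradient (M (X k i ω)) (θ k)‖ := by
  -- A common lower bound for the weights makes `γ₀ * c` a coercivity constant for all limiting
  -- Hessians. Taking it close to `0` avoids a minimum over a possibly empty index set.
  obtain ⟨γ₀, hγ, hγ₀⟩ : ∃ γ₀ : ℝ, (∀ k, γ₀ ≤ γ k) ∧ 0 < γ₀ := by
    have h1 : ∀ᶠ t in 𝓝[>] (0 : ℝ), ∀ k, t ≤ γ k := eventually_all.2 fun k => by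
      filter_upwards [Ioc_mem_nhdsGT (hn.limit_pos k)] with t ht using ht.2
    exact (h1.and self_mem_nhdsWithin).exists
  have e1 := ae_all_iff.2 fun k => hX.strong_law hn k (hreg k).integrable_hess
  have e2 := ae_all_iff.2 fun k => hX.strong_law hn k (hreg k).integrable_lipschitz
  have e3 := ae_all_iff.2 fun k =>
    hX.strong_law hn k ((hreg k).memLp_score.integrable (by norm_num))
  filter_upwards [e1, e2, e3, ae_all_iff.2 hδ] with ω h1 h2 h3 h4
  have hN : ∀ m, 0 ≤ (total n m)⁻¹ := fun m => by positivity
  refine isLittleO_constrained_argmin V (Θ := Θ) (θ := θ) (H := fun k =>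
      γ k • Matrix.toEuclideanCLM (𝕜 := ℝ) (popHess (F k) M (θ k)))
    (f := fun m k η => (total n m)⁻¹ * empObj M (fun i => X k i ω) (n m k) η)
    (g := fun m k η => (total n m)⁻¹ • ∑ i ∈ Finset.range (n m k), gradient (M (X k i ω)) η)
    (A := fun m k => (total n m)⁻¹ •
      ∑ i ∈ Finset.range (n m k), fderiv ℝ (gradient (M (X k i ω))) (θ k))
    (Q := fun m k => q m k • Matrix.toEuclideanCLM (𝕜 := ℝ) (popHess (F k) M (θ k)))
    (C := fun m k => (total n m)⁻¹ • ∑ i ∈ Finset.range (n m k), |G (X k i ω)|)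
    (δ := fun m => δ m ω) hr (mul_pos hγ₀ hc) (fun k => (hreg k).ball_subset)
    (fun m k => ?_) (fun m k η hη => ?_) (fun m k u hu => ?_) (fun k u => ?_)
    (fun k => ?_) (fun k => (hq k).smul_const _) h2 (fun k => ?_) (fun m => (h4 m).1)
    (fun m => (h4 m).2.1) (fun m δ' hδ' hf => ?_) hh
  · have h5 : ConvexOn ℝ (Θ k) fun η => empObj M (fun i => X k i ω) (n m k) η := by
      unfold empObj
      induction n m k with
      -- For the empty sum only convexity of `Θ k` is needed; it is read off from the objective at
      -- the arbitrary observation `0`.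
      | zero => simpa using convexOn_const (0 : ℝ) ((hreg k).convex_obj 0).1
      | succ N ih =>
        simp_rw [Finset.sum_range_succ]
        exact ih.add ((hreg k).convex_obj _)
    exact h5.smul (hN m)
  · have h5 : HasFDerivAt (empObj M (fun i => X k i ω) (n m k))
        (∑ i ∈ Finset.range (n m k), fderiv ℝ (M (X k i ω)) η) η :=
      HasFDerivAt.fun_sum fun i _ => ((hreg k).differentiable _ η hη).hasFDerivAt
    have h6 := h5.const_mul (total n m)⁻¹
    have h7 : InnerProductSpace.toDual ℝ (Param p₁ p₂) ((total n m)⁻¹ •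
        ∑ i ∈ Finset.range (n m k), gradient (M (X k i ω)) η)
        = (total n m)⁻¹ • ∑ i ∈ Finset.range (n m k), fderiv ℝ (M (X k i ω)) η := by
      simp only [← toDual_gradient, map_sum, LinearIsometryEquiv.map_smulₛₗ, RCLike.conj_to_real]
    rw [hasGradientAt_iff_hasFDerivAt, h7]
    exact h6
  · rw [← smul_sub, ← Finset.sum_sub_distrib, smul_apply, ← smul_sub, sum_apply,
      ← Finset.sum_sub_distrib, norm_smul, Real.norm_of_nonneg (hN m), smul_eq_mul, mul_assoc,
      Finset.sum_mul]
    exact mul_le_mul_of_nonneg_left (norm_sum_le_of_le _ fun i _ => (hreg k).expansion _ _ hu)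
      (hN m)
  · have h5 := (hreg k).inner_popHess_ge u
    rw [smul_apply, inner_smul_left]
    calc γ₀ * c * ‖u‖ ^ 2 ≤ γ k * (c * ‖u‖ ^ 2) := by
          rw [mul_assoc]
          exact mul_le_mul_of_nonneg_right (hγ k) (by positivity)
      _ ≤ _ := mul_le_mul_of_nonneg_left h5 (hn.limit_pos k).le
  · have h5 := h1 k
    rwa [(hreg k).integral_hess] at h5
  · have h5 := h3 k
    rwa [(hreg k).integral_score, smul_zero] at h5
  · rw [← Finset.mul_sum, ← Finset.mul_sum]
    exact mul_le_mul_of_nonneg_left ((h4 m).2.2 δ' hδ' hf) (hN m)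

variable [IsProbabilityMeasure P]

/-- Linearization of the estimators in probability: the displacements of the estimators and the
normalized scores satisfy the linearized first order condition up to an error which tends to zero
in probability. -/
theorem tendstoInMeasure_argmin (hr : 0 < r) (hc : 0 < c)
    (hreg : ∀ k, BlockRegular (F k) M (Θ k) (θ k) G c r) (hn : SampleSizes n γ)
    (hX : IsSample P X F) {q : ℕ → Fin K → ℝ}
    (hq : ∀ k, Tendsto (fun m => q m k) atTop (𝓝 (γ k)))
    (V : Submodule ℝ (Fin K → Param p₁ p₂)) {δ : ℕ → Ω → Fin K → Param p₁ p₂}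
    (hmeas : ∀ m k, AEMeasurable (fun ω => δ m ω k) P)
    (hδ : ∀ m, ∀ᵐ ω ∂P, δ m ω ∈ V ∧ (∀ k, θ k + δ m ω k ∈ Θ k) ∧
      ∀ δ' ∈ V, (∀ k, θ k + δ' k ∈ Θ k) →
        ∑ k, empObj M (fun i => X k i ω) (n m k) (θ k + δ m ω k)
          ≤ ∑ k, empObj M (fun i => X k i ω) (n m k) (θ k + δ' k))
    {h : Fin K → Param p₁ p₂} (hh : h ∈ V) :
    TendstoInMeasure P (fun m ω =>
      √(total n m) * (∑ k, q m k *
        ⟪Matrix.toEuclideanCLM (𝕜 := ℝ) (popHess (F k) M (θ k)) (δ m ω k), h k⟫_ℝ)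
      + (√(total n m))⁻¹ *
        ∑ k, ∑ i ∈ Finset.range (n m k), ⟪gradient (M (X k i ω)) (θ k), h k⟫_ℝ) atTop 0 := by
  set R : ℕ → Ω → ℝ := fun m ω => √(total n m) * (∑ k, q m k *
        ⟪Matrix.toEuclideanCLM (𝕜 := ℝ) (popHess (F k) M (θ k)) (δ m ω k), h k⟫_ℝ)
      + (√(total n m))⁻¹ *
        ∑ k, ∑ i ∈ Finset.range (n m k), ⟪gradient (M (X k i ω)) (θ k), h k⟫_ℝ with hR
  set S : ℕ → Fin K → Ω → Param p₁ p₂ := fun m k ω =>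
    (√(total n m))⁻¹ • ∑ i ∈ Finset.range (n m k), gradient (M (X k i ω)) (θ k) with hS
  -- Since `t ≤ 1 + t ^ 2`, `Z` dominates `∑ k, ‖S m k ω‖`, so `R / Z` tends to zero almost surely;
  -- and `Z` is bounded in `L¹`, so multiplying it back preserves convergence in probability. The
  -- leading `1` keeps `Z` positive even without blocks.
  set Z : ℕ → Ω → ℝ := fun m ω => 1 + ∑ k, (1 + ‖S m k ω‖ ^ 2) with hZ
  have hgmeas : ∀ k, AEMeasurable (fun x => gradient (M x) (θ k)) (F k) := fun k =>
    (hreg k).memLp_score.1.aemeasurable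
  have hZ1 : ∀ m ω, 1 ≤ Z m ω := fun m ω => by
    have : 0 ≤ ∑ k, (1 + ‖S m k ω‖ ^ 2) := Finset.sum_nonneg fun k _ => by positivity
    simp only [hZ]; linarith
  -- the normalized sums of scores are bounded in `L²`
  have hcoord : ∀ m k ω, ‖S m k ω‖ ^ 2 = ∑ a, ((√(total n m))⁻¹ *
      ∑ i ∈ Finset.range (n m k), gradient (M (X k i ω)) (θ k) a) ^ 2 := fun m k ω => by
    rw [EuclideanSpace.real_norm_sq_eq]
    simp [hS]
  have hL2 : ∀ k a, MemLp (fun x => gradient (M x) (θ k) a) 2 (F k) := fun k a =>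
    (EuclideanSpace.proj (𝕜 := ℝ) a).comp_memLp' (hreg k).memLp_score
  have hL0 : ∀ k a, ∫ x, gradient (M x) (θ k) a ∂F k = 0 := fun k a => by
    have := (EuclideanSpace.proj (𝕜 := ℝ) a).integral_comp_comm
      ((hreg k).memLp_score.integrable (by norm_num))
    rw [(hreg k).integral_score] at this
    simpa using this
  have hSint : ∀ m k, Integrable (fun ω => ‖S m k ω‖ ^ 2) P := fun m k => by
    simp_rw [hcoord]
    exact integrable_finsetSum _ fun a _ => (hX.integral_sq_le k (hL2 k a) (hL0 k a) m).1
  have hSle : ∀ m k, ∫ ω, ‖S m k ω‖ ^ 2 ∂P ≤ ∑ a, ∫ x, gradient (M x) (θ k) a ^ 2 ∂F k :=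
    fun m k => by
      simp_rw [hcoord]
      rw [integral_finsetSum _ fun a _ => (hX.integral_sq_le k (hL2 k a) (hL0 k a) m).1]
      exact Finset.sum_le_sum fun a _ => (hX.integral_sq_le k (hL2 k a) (hL0 k a) m).2
  have hZint' : ∀ m, Integrable (fun ω => ∑ k, (1 + ‖S m k ω‖ ^ 2)) P := fun m =>
    integrable_finsetSum _ fun k _ => (integrable_const 1).add (hSint m k)
  have hZint : ∀ m, Integrable (Z m) P := fun m => (integrable_const 1).add (hZint' m)
  have hZle : ∀ m, ∫ ω, Z m ω ∂P
      ≤ 1 + ∑ k, (1 + ∑ a, ∫ x, gradient (M x) (θ k) a ^ 2 ∂F k) := fun m => by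
    simp only [hZ]
    have hint : ∀ k ∈ Finset.univ, Integrable (fun ω => 1 + ‖S m k ω‖ ^ 2) P := fun k _ =>
      (integrable_const 1).add (hSint m k)
    rw [integral_add (integrable_const 1) (hZint' m), integral_finsetSum _ hint]
    simp_rw [integral_add (integrable_const (1 : ℝ)) (hSint m _)]
    simp only [integral_const, probReal_univ, smul_eq_mul, mul_one]
    exact add_le_add le_rfl (Finset.sum_le_sum fun k _ => add_le_add le_rfl (hSle m k))
  -- the quotient tends to zero almost surely
  have hRmeas : ∀ m, AEMeasurable (R m) P := fun m => by
    refine AEMeasurable.add (AEMeasurable.const_mul (Finset.aemeasurable_fun_sum _ fun k _ => ?_) _)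
      (AEMeasurable.const_mul (Finset.aemeasurable_fun_sum _ fun k _ =>
        Finset.aemeasurable_fun_sum _ fun i _ => ?_) _)
    · have hcont : Continuous fun u : Param p₁ p₂ =>
        ⟪Matrix.toEuclideanCLM (𝕜 := ℝ) (popHess (F k) M (θ k)) u, h k⟫_ℝ := by fun_prop
      exact (hcont.measurable.comp_aemeasurable (hmeas m k)).const_mul _
    · exact (by fun_prop : Continuous fun u : Param p₁ p₂ =>
        ⟪u, h k⟫_ℝ).measurable.comp_aemeasurable (hX.aemeasurable_comp k (hgmeas k) i)
  have hη : TendstoInMeasure P (fun m ω => R m ω / Z m ω) atTop 0 := by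
    refine tendstoInMeasure_of_tendsto_ae
      (fun m => ((hRmeas m).div (hZint m).1.aemeasurable).aestronglyMeasurable) ?_
    filter_upwards [ae_isLittleO_argmin hr hc hreg hn hX hq V hδ hh] with ω hω
    rw [Pi.zero_apply, Metric.tendsto_nhds]
    intro ε hε
    filter_upwards [Asymptotics.isLittleO_iff.1 hω (half_pos hε)] with m hm
    have hsq : √(total n m) * (total n m)⁻¹ = (√(total n m))⁻¹ := by
      rw [← div_eq_mul_inv, Real.sqrt_div_self']
      exact one_div _
    have hRe : R m ω = √(total n m) * ∑ k,
        ⟪q m k • Matrix.toEuclideanCLM (𝕜 := ℝ) (popHess (F k) M (θ k)) (δ m ω k)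
          + (total n m)⁻¹ • ∑ i ∈ Finset.range (n m k), gradient (M (X k i ω)) (θ k), h k⟫_ℝ := by
      simp only [hR, inner_add_left, inner_smul_left, sum_inner, Finset.sum_add_distrib, mul_add,
        ← Finset.mul_sum, RCLike.conj_to_real]
      rw [← mul_assoc (√(total n m)) (total n m)⁻¹, hsq]
    have hSe : √(total n m) * ∑ k, ‖(total n m)⁻¹ • ∑ i ∈ Finset.range (n m k),
        gradient (M (X k i ω)) (θ k)‖ = ∑ k, ‖S m k ω‖ := by
      rw [Finset.mul_sum]
      refine Finset.sum_congr rfl fun k _ => ?_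
      rw [← Real.norm_of_nonneg (Real.sqrt_nonneg (total n m)), ← norm_smul, smul_smul,
        hsq]
    have hSZ : ∑ k, ‖S m k ω‖ ≤ Z m ω := by
      have : ∑ k, ‖S m k ω‖ ≤ ∑ k, (1 + ‖S m k ω‖ ^ 2) := Finset.sum_le_sum fun k _ => by
        nlinarith [sq_nonneg (‖S m k ω‖ - 1), norm_nonneg (S m k ω)]
      simp only [hZ]; linarith
    have hb : ‖R m ω‖ ≤ ε / 2 * Z m ω := by
      rw [hRe, norm_mul, Real.norm_of_nonneg (Real.sqrt_nonneg _)]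
      refine (mul_le_mul_of_nonneg_left hm (Real.sqrt_nonneg _)).trans ?_
      rw [Real.norm_of_nonneg (Finset.sum_nonneg fun k _ => norm_nonneg _), mul_left_comm, hSe]
      exact mul_le_mul_of_nonneg_left hSZ (by positivity)
    have hZpos : 0 < Z m ω := zero_lt_one.trans_le (hZ1 m ω)
    rw [dist_zero_right, norm_div, Real.norm_of_nonneg hZpos.le, div_lt_iff₀ hZpos]
    refine hb.trans_lt (mul_lt_mul_of_pos_right (by linarith) hZpos)
  have := tendstoInMeasure_mul_of_integral_le hη hZint
    (fun m ω => zero_le_one.trans (hZ1 m ω)) hZle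
  refine this.congr_left fun m => Eventually.of_forall fun ω => ?_
  exact div_mul_cancel₀ _ (zero_lt_one.trans_le (hZ1 m ω)).ne'

end Linearization

/-! ### Schur complements -/

section Schur

variable {Ψ : Matrix (Fin p₁ ⊕ Fin p₂) (Fin p₁ ⊕ Fin p₂) ℝ}

/-- The Schur complement of the lower right block. -/
noncomputable def schur (Ψ : Matrix (Fin p₁ ⊕ Fin p₂) (Fin p₁ ⊕ Fin p₂) ℝ) :
    Matrix (Fin p₁) (Fin p₁) ℝ :=
  Ψ.toBlocks₁₁ - Ψ.toBlocks₁₂ * Ψ.toBlocks₂₂⁻¹ * Ψ.toBlocks₂₁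

/-- The least favourable direction `(v, -Ψ₂₂⁻¹ Ψ₂₁ v)`. -/
noncomputable def schurDir (Ψ : Matrix (Fin p₁ ⊕ Fin p₂) (Fin p₁ ⊕ Fin p₂) ℝ) (v : Fin p₁ → ℝ) :
    Param p₁ p₂ :=
  WithLp.toLp 2 (Sum.elim v (-(Ψ.toBlocks₂₂⁻¹.mulVec (Ψ.toBlocks₂₁.mulVec v))))

theorem posDef_toBlocks₂₂ (hΨ : Ψ.PosDef) : Ψ.toBlocks₂₂.PosDef :=
  hΨ.submatrix Sum.inr_injective

/-- The `λ`-component is chosen to cancel the lower block, and the upper block then becomes the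
Schur complement. This is what hides nuisance displacements in the linearized condition. -/
theorem mulVec_schurDir (hΨ : Ψ.PosDef) (v : Fin p₁ → ℝ) :
    Ψ.mulVec (schurDir Ψ v) = Sum.elim ((schur Ψ).mulVec v) 0 := by
  have h22 := (posDef_toBlocks₂₂ hΨ).isUnit
  have h := Matrix.fromBlocks_mulVec Ψ.toBlocks₁₁ Ψ.toBlocks₁₂ Ψ.toBlocks₂₁ Ψ.toBlocks₂₂
    (schurDir Ψ v)
  rw [Matrix.fromBlocks_toBlocks] at h
  rw [h]
  congr 1
  · simp only [schurDir, schur, Sum.elim_comp_inl, Sum.elim_comp_inr, Matrix.mulVec_neg,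
      Matrix.sub_mulVec, Matrix.mulVec_mulVec, Matrix.mul_assoc]
    exact (sub_eq_add_neg _ _).symm
  · simp only [schurDir, Sum.elim_comp_inl, Sum.elim_comp_inr, Matrix.mulVec_neg,
      Matrix.mulVec_mulVec]
    rw [← Matrix.mul_assoc, Matrix.mul_nonsing_inv _ ((Matrix.isUnit_iff_isUnit_det _).1 h22),
      Matrix.one_mul, add_neg_cancel]

theorem transpose_eq_self_of_posDef {m : Type*} {A : Matrix m m ℝ} (hA : A.PosDef) :
    Matrix.transpose A = A := by
  simpa [Matrix.IsHermitian, Matrix.conjTranspose_eq_transpose_of_trivial] using hA.isHermitian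

theorem dotProduct_schurDir (v : Fin p₁ → ℝ) (u : Fin p₁ → ℝ) :
    (schurDir Ψ u).ofLp ⬝ᵥ Sum.elim v (0 : Fin p₂ → ℝ) = u ⬝ᵥ v := by
  simp [schurDir, dotProduct]

theorem schur_transpose (hΨ : Ψ.PosDef) : Matrix.transpose (schur Ψ) = schur Ψ := by
  have h := transpose_eq_self_of_posDef hΨ
  have h11 : Matrix.transpose Ψ.toBlocks₁₁ = Ψ.toBlocks₁₁ := by
    ext i j; exact congrFun (congrFun h (Sum.inl i)) (Sum.inl j)
  have h12 : Matrix.transpose Ψ.toBlocks₁₂ = Ψ.toBlocks₂₁ := by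
    ext i j; exact congrFun (congrFun h (Sum.inr i)) (Sum.inl j)
  have h21 : Matrix.transpose Ψ.toBlocks₂₁ = Ψ.toBlocks₁₂ := by
    ext i j; exact congrFun (congrFun h (Sum.inl i)) (Sum.inr j)
  have h22 := transpose_eq_self_of_posDef (posDef_toBlocks₂₂ hΨ)
  rw [schur, Matrix.transpose_sub, Matrix.transpose_mul, Matrix.transpose_mul, h11, h12, h21,
    Matrix.transpose_nonsing_inv, h22, Matrix.mul_assoc]

/-- The quadratic form of the Schur complement at `v` is that of `Ψ` at `schurDir Ψ v`, which is
nonzero when `v` is. -/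
theorem posDef_schur (hΨ : Ψ.PosDef) : (schur Ψ).PosDef := by
  refine .of_dotProduct_mulVec_pos ?_ fun v hv => ?_
  · rw [Matrix.IsHermitian, Matrix.conjTranspose_eq_transpose_of_trivial, schur_transpose hΨ]
  · have h1 : (schurDir Ψ v).ofLp ≠ 0 := fun h => hv <| funext fun a => by
      simpa [schurDir] using congrFun h (Sum.inl a)
    have h2 := hΨ.dotProduct_mulVec_pos h1
    rwa [mulVec_schurDir hΨ, star_trivial, dotProduct_schurDir] at h2

/-- In the least favourable direction only the common component of the displacement is seen. -/
theorem inner_popHess_schurDir (hΨ : Ψ.PosDef) (δ : Param p₁ p₂) (v : Fin p₁ → ℝ) :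
    ⟪Matrix.toEuclideanCLM (𝕜 := ℝ) Ψ δ, schurDir Ψ v⟫_ℝ
      = (common δ).ofLp ⬝ᵥ (schur Ψ).mulVec v := by
  rw [inner_toEuclideanCLM, Matrix.dotProduct_mulVec, ← Matrix.mulVec_transpose,
    transpose_eq_self_of_posDef hΨ, mulVec_schurDir hΨ, dotProduct_comm]
  simp [common, dotProduct]

/-- Moving `Ψ₂₂⁻¹ Ψ₂₁` across the dot product by symmetry of `Ψ` turns a gradient tested in the
least favourable direction into the adjusted score. -/
theorem inner_schurDir (hΨ : Ψ.PosDef) (g : Param p₁ p₂) (v : Fin p₁ → ℝ) :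
    ⟪g, schurDir Ψ v⟫_ℝ = v ⬝ᵥ ((fun a => g (Sum.inl a)) -
      (Ψ.toBlocks₁₂ * Ψ.toBlocks₂₂⁻¹).mulVec fun b => g (Sum.inr b)) := by
  have h := transpose_eq_self_of_posDef hΨ
  have h12 : Matrix.transpose Ψ.toBlocks₁₂ = Ψ.toBlocks₂₁ := by
    ext i j; exact congrFun (congrFun h (Sum.inr i)) (Sum.inl j)
  have h22 := transpose_eq_self_of_posDef (posDef_toBlocks₂₂ hΨ)
  have e : v ⬝ᵥ ((Ψ.toBlocks₁₂ * Ψ.toBlocks₂₂⁻¹).mulVec fun b => g (Sum.inr b))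
      = (Ψ.toBlocks₂₂⁻¹.mulVec (Ψ.toBlocks₂₁.mulVec v)) ⬝ᵥ fun b => g (Sum.inr b) := by
    rw [Matrix.dotProduct_mulVec, ← Matrix.mulVec_transpose, Matrix.transpose_mul,
      Matrix.transpose_nonsing_inv, h12, h22, Matrix.mulVec_mulVec]
  rw [dotProduct_sub, e, EuclideanSpace.inner_eq_star_dotProduct]
  simp [schurDir, dotProduct, sub_eq_add_neg]

end Schur

/-! ### Covariances -/

section Covariance

variable {F : Measure (Obs d)} {M : Obs d → Param p₁ p₂ → ℝ} {Θ : Set (Param p₁ p₂)}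
  {θ : Param p₁ p₂} {G : Obs d → ℝ} {c r : ℝ}

theorem BlockRegular.posDef (hc : 0 < c) (hreg : BlockRegular F M Θ θ G c r) :
    (popHess F M θ).PosDef := by
  have h := Matrix.PosDef.posSemidef_add hreg.posSemidef (Matrix.PosDef.one.smul hc)
  rwa [sub_add_cancel] at h

theorem BlockRegular.posDef_partialHess (hc : 0 < c) (hreg : BlockRegular F M Θ θ G c r) :
    (partialHess F M θ).PosDef :=
  posDef_schur (hreg.posDef hc)

theorem BlockRegular.inner_gradient_schurDir (hc : 0 < c) (hreg : BlockRegular F M Θ θ G c r)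
    (x : Obs d) (v : Fin p₁ → ℝ) :
    ⟪gradient (M x) θ, schurDir (popHess F M θ) v⟫_ℝ = v ⬝ᵥ adjScore F M θ x :=
  inner_schurDir (hreg.posDef hc) _ v

theorem BlockRegular.memLp_inner (hreg : BlockRegular F M Θ θ G c r) (u : Param p₁ p₂) :
    MemLp (fun x => ⟪gradient (M x) θ, u⟫_ℝ) 2 F :=
  hreg.memLp_score.inner_const u

variable [IsProbabilityMeasure F]

theorem BlockRegular.integral_inner (hreg : BlockRegular F M Θ θ G c r) (u : Param p₁ p₂) :
    ∫ x, ⟪gradient (M x) θ, u⟫_ℝ ∂F = 0 := by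
  have h := _root_.integral_inner (𝕜 := ℝ)
    (hreg.memLp_score.integrable (by norm_num)) u
  rw [hreg.integral_score, inner_zero_right] at h
  rw [← h]
  exact integral_congr_ae (Eventually.of_forall fun x => real_inner_comm _ _)

theorem BlockRegular.variance_inner_schurDir (hc : 0 < c) (hreg : BlockRegular F M Θ θ G c r)
    (v : Fin p₁ → ℝ) :
    Var[fun x => ⟪gradient (M x) θ, schurDir (popHess F M θ) v⟫_ℝ; F]
      = v ⬝ᵥ (scoreVar F M θ).mulVec v := by
  -- Coordinate `a` of the adjusted score is the score in the least favourable direction of the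
  -- basis vector `Pi.single a 1`, hence square integrable.
  have h1 : ∀ a, MemLp (fun x => adjScore F M θ x a) 2 F := fun a => by
    refine (hreg.memLp_inner (schurDir (popHess F M θ) (Pi.single a 1))).ae_eq
      (Eventually.of_forall fun x => ?_)
    simp only
    rw [hreg.inner_gradient_schurDir hc, single_one_dotProduct]
  have h2 : ∀ a, MemLp (fun x => v a * adjScore F M θ x a) 2 F := fun a => (h1 a).const_mul _
  simp_rw [hreg.inner_gradient_schurDir hc, dotProduct]
  rw [← covariance_self (memLp_finsetSum _ fun a _ => h2 a).1.aemeasurable,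
    covariance_fun_sum_fun_sum h2 h2]
  refine Finset.sum_congr rfl fun a _ => ?_
  simp_rw [covariance_const_mul_left, covariance_const_mul_right, Matrix.mulVec, dotProduct,
    Finset.mul_sum, scoreVar, Matrix.of_apply]
  refine Finset.sum_congr rfl fun b _ => ?_
  ring

theorem BlockRegular.posSemidef_scoreVar (hc : 0 < c) (hreg : BlockRegular F M Θ θ G c r) :
    (scoreVar F M θ).PosSemidef := by
  refine .of_dotProduct_mulVec_nonneg ?_ fun v => ?_
  · ext a b
    simp [scoreVar, covariance_comm]
  · rw [star_trivial, ← hreg.variance_inner_schurDir hc]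
    exact variance_nonneg _ _

end Covariance

/-! ### Sandwich matrices -/

theorem posSemidef_conj_inv {p : ℕ} {A S : Matrix (Fin p) (Fin p) ℝ} (hA : A.PosDef)
    (hS : S.PosSemidef) : (A⁻¹ * S * A⁻¹).PosSemidef := by
  have h := hS.mul_mul_conjTranspose_same A⁻¹
  rwa [hA.inv.isHermitian] at h

theorem dotProduct_conj_inv {p : ℕ} {A S : Matrix (Fin p) (Fin p) ℝ} (hA : A.PosDef)
    (v : Fin p → ℝ) :
    v ⬝ᵥ (A⁻¹ * S * A⁻¹).mulVec v = (A⁻¹.mulVec v) ⬝ᵥ S.mulVec (A⁻¹.mulVec v) := by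
  rw [Matrix.mul_assoc, ← Matrix.mulVec_mulVec, ← Matrix.mulVec_mulVec,
    Matrix.dotProduct_mulVec v, ← Matrix.mulVec_transpose, transpose_eq_self_of_posDef hA.inv]

theorem mulVec_inv_mulVec {p : ℕ} {A : Matrix (Fin p) (Fin p) ℝ} (hA : A.PosDef)
    (v : Fin p → ℝ) : A.mulVec (A⁻¹.mulVec v) = v := by
  rw [Matrix.mulVec_mulVec,
    Matrix.mul_nonsing_inv _ ((Matrix.isUnit_iff_isUnit_det _).1 hA.isUnit), Matrix.one_mulVec]

/-! ### Asymptotic normality -/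

section Normality

variable {Ω : Type*} [MeasurableSpace Ω] {P : Measure Ω} [IsProbabilityMeasure P]
  {X : Fin K → ℕ → Ω → Obs d} {F : Fin K → Measure (Obs d)} {M : Obs d → Param p₁ p₂ → ℝ}
  {Θ : Fin K → Set (Param p₁ p₂)} {θ : Fin K → Param p₁ p₂} {n : ℕ → Fin K → ℕ} {γ : Fin K → ℝ}
  {G : Obs d → ℝ} {c r : ℝ} [∀ k, IsProbabilityMeasure (F k)]

/-- A statistic whose inner products with fixed vectors are asymptotically linear in the adjusted
scores is asymptotically normal. -/
theorem tendstoInDistribution_of_linear (hc : 0 < c)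
    (hreg : ∀ k, BlockRegular (F k) M (Θ k) (θ k) G c r) (hn : SampleSizes n γ)
    (hX : IsSample P X F) {S : ℕ → Ω → EuclideanSpace ℝ (Fin p₁)}
    (hS : ∀ m, AEMeasurable (S m) P) {C : Matrix (Fin p₁) (Fin p₁) ℝ} (hC : C.PosSemidef)
    (u : (Fin p₁ → ℝ) → Fin K → Fin p₁ → ℝ)
    (hu : ∀ v, v ⬝ᵥ C.mulVec v
      = ∑ k, γ k * (u v k ⬝ᵥ (scoreVar (F k) M (θ k)).mulVec (u v k)))
    (hlin : ∀ v : EuclideanSpace ℝ (Fin p₁), TendstoInMeasure P (fun m ω => ⟪S m ω, v⟫_ℝ +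
      (√(total n m))⁻¹ * ∑ k, ∑ i ∈ Finset.range (n m k),
        ⟪gradient (M (X k i ω)) (θ k), schurDir (popHess (F k) M (θ k)) (u v k)⟫_ℝ) atTop 0) :
    TendstoInDistribution S atTop id (fun _ => P) (multivariateGaussian 0 C) := by
  refine tendstoInDistribution_multivariateGaussian hC hS fun v => ?_
  -- The linear relation puts `S` and the scores on the same side, so `S` follows the negative
  -- scores; the sign does not change the variance.
  set f : Fin K → Obs d → ℝ := fun k x =>
    -⟪gradient (M x) (θ k), schurDir (popHess (F k) M (θ k)) (u v k)⟫_ℝ with hf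
  have h1 := hX.tendstoInDistribution_sum hn (f := f) (fun k => ((hreg k).memLp_inner _).neg)
    (fun k => by simp only [hf]; rw [integral_neg, (hreg k).integral_inner, neg_zero])
  have h2 : ∑ k, γ k * Var[f k; F k] = v.ofLp ⬝ᵥ C.mulVec v.ofLp := by
    rw [hu]
    refine Finset.sum_congr rfl fun k _ => ?_
    rw [← (hreg k).variance_inner_schurDir hc]
    congr 1
    exact variance_fun_neg
  rw [h2] at h1
  refine tendstoInDistribution_of_tendstoInMeasure_sub _ _ h1 ?_ fun m =>
    (by fun_prop : Continuous fun w : EuclideanSpace ℝ (Fin p₁) =>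
      ⟪w, v⟫_ℝ).measurable.comp_aemeasurable (hS m)
  refine (hlin v).congr_left fun m => Eventually.of_forall fun ω => ?_
  simp [hf, sub_eq_add_neg]

end Normality

/-! ### The two estimators -/

theorem common_sub (θ η : Param p₁ p₂) : common (θ - η) = common θ - common η := rfl

theorem common_add (θ η : Param p₁ p₂) : common (θ + η) = common θ + common η := rfl

theorem common_smul (t : ℝ) (θ : Param p₁ p₂) : common (t • θ) = t • common θ := rfl

theorem common_join (φ : EuclideanSpace ℝ (Fin p₁)) (l : EuclideanSpace ℝ (Fin p₂)) :
    common (join φ l) = φ := rfl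

theorem join_common (θ : Param p₁ p₂) :
    join (common θ) (WithLp.toLp 2 fun b => θ (Sum.inr b)) = θ := by
  ext (a | b) <;> rfl

theorem continuous_common : Continuous (common : Param p₁ p₂ → EuclideanSpace ℝ (Fin p₁)) := by
  unfold common
  fun_prop

theorem continuous_join :
    Continuous fun t : EuclideanSpace ℝ (Fin p₁) × EuclideanSpace ℝ (Fin p₂) => join t.1 t.2 := by
  refine (PiLp.continuous_toLp 2 _).comp (continuous_pi fun a => ?_)
  cases a <;> simp only [Sum.elim_inl, Sum.elim_inr] <;> fun_prop

theorem common_schurDir (Ψ : Matrix (Fin p₁ ⊕ Fin p₂) (Fin p₁ ⊕ Fin p₂) ℝ) (v : Fin p₁ → ℝ) :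
    common (schurDir Ψ v) = WithLp.toLp 2 v := rfl

/-- The displacements of the block parameters which keep a common component. -/
def commonSubmodule (p₁ p₂ K : ℕ) : Submodule ℝ (Fin K → Param p₁ p₂) where
  carrier := {δ | ∃ φ, ∀ k, common (δ k) = φ}
  add_mem' := by
    rintro δ δ' ⟨φ, h⟩ ⟨φ', h'⟩
    exact ⟨φ + φ', fun k => by rw [Pi.add_apply, common_add, h, h']⟩
  zero_mem' := ⟨0, fun k => rfl⟩
  smul_mem' := by
    rintro t δ ⟨φ, h⟩
    exact ⟨t • φ, fun k => by rw [Pi.smul_apply, common_smul, h]⟩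

section Estimators

variable {Ω : Type*} [MeasurableSpace Ω] {P : Measure Ω}
  {X : Fin K → ℕ → Ω → Obs d} {F : Fin K → Measure (Obs d)} {M : Obs d → Param p₁ p₂ → ℝ}
  {Θ : Fin K → Set (Param p₁ p₂)} {φs : EuclideanSpace ℝ (Fin p₁)}
  {ls : Fin K → EuclideanSpace ℝ (Fin p₂)} {n : ℕ → Fin K → ℕ} {γ : Fin K → ℝ}
  {G : Obs d → ℝ} {c r : ℝ}

theorem aemeasurable_sacEstimator {T : ℕ → Fin K → Ω → Param p₁ p₂}
    (hT : IsLocalEstimator P M Θ X n T) (m : ℕ) : AEMeasurable (sacEstimator n T m) P := by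
  have h : AEMeasurable (fun ω => ∑ k, (n m k : ℝ) • common (T m k ω)) P :=
    Finset.aemeasurable_fun_sum _ fun k _ =>
      (continuous_common.measurable.comp_aemeasurable (hT.aemeasurable m k)).const_smul (n m k : ℝ)
  exact h.const_smul (total n m)⁻¹

variable [IsProbabilityMeasure P] [∀ k, IsProbabilityMeasure (F k)]

/-- Asymptotic normality of the split-and-conquer estimator. -/
theorem tendstoInDistribution_sac (hr : 0 < r) (hc : 0 < c)
    (hreg : ∀ k, BlockRegular (F k) M (Θ k) (join φs (ls k)) G c r) (hn : SampleSizes n γ)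
    (hX : IsSample P X F) {T : ℕ → Fin K → Ω → Param p₁ p₂}
    (hT : IsLocalEstimator P M Θ X n T) :
    TendstoInDistribution (fun m ω => √(total n m) • (sacEstimator n T m ω - φs)) atTop id
      (fun _ => P) (multivariateGaussian 0 (covSaC F M (fun k => join φs (ls k)) γ)) := by
  have hJ := fun k => (hreg k).posDef_partialHess hc
  refine tendstoInDistribution_of_linear hc hreg hn hX
    (fun m => ((aemeasurable_sacEstimator hT m).sub_const _).const_smul (√(total n m))) ?_
    (fun v k => (partialHess (F k) M (join φs (ls k)))⁻¹.mulVec v) (fun v => ?_) (fun v => ?_)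
  · exact Matrix.posSemidef_sum _ fun k _ =>
      (posSemidef_conj_inv (hJ k) ((hreg k).posSemidef_scoreVar hc)).smul (hn.limit_pos k).le
  · rw [covSaC, Matrix.sum_mulVec, dotProduct_sum]
    refine Finset.sum_congr rfl fun k _ => ?_
    rw [Matrix.smul_mulVec, dotProduct_smul, smul_eq_mul, dotProduct_conj_inv (hJ k)]
  -- With no constraint the blocks decouple, so local minimizers minimize the sum. The weights `n_k
  -- / N` and the directions built from `J_k⁻¹ v` make the Hessian term exactly the displacement of
  -- the averaged estimator along `v`.
  · have h1 := tendstoInMeasure_argmin hr hc hreg hn hX hn.ratio_tendsto ⊤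
      (δ := fun m ω k => T m k ω - join φs (ls k))
      (fun m k => (hT.aemeasurable m k).sub_const _) (fun m => ?_)
      (h := fun k => schurDir (popHess (F k) M (join φs (ls k)))
        ((partialHess (F k) M (join φs (ls k)))⁻¹.mulVec v)) trivial
    · refine h1.congr_left fun m => Eventually.of_forall fun ω => ?_
      simp only
      congr 1
      have h2 : ∀ k, ⟪Matrix.toEuclideanCLM (𝕜 := ℝ) (popHess (F k) M (join φs (ls k)))
          (T m k ω - join φs (ls k)), schurDir (popHess (F k) M (join φs (ls k)))
            ((partialHess (F k) M (join φs (ls k)))⁻¹.mulVec v)⟫_ℝ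
          = ⟪common (T m k ω) - φs, v⟫_ℝ := fun k => by
        rw [inner_popHess_schurDir ((hreg k).posDef hc)]
        change _ ⬝ᵥ (partialHess (F k) M (join φs (ls k))).mulVec _ = _
        rw [mulVec_inv_mulVec (hJ k), common_sub, common_join,
          EuclideanSpace.inner_eq_star_dotProduct, star_trivial, dotProduct_comm]
      simp_rw [h2]
      rw [Pi.smul_apply, inner_smul_left, RCLike.conj_to_real]
      -- The weights sum to one only for `N ≠ 0`; for `N = 0` both sides carry the factor `√0 = 0`.
      by_cases hN : total n m = 0
      · simp [hN]
      congr 1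
      have h3 : sacEstimator n T m ω - φs
          = ∑ k, ((n m k : ℝ) / total n m) • (common (T m k ω) - φs) := by
        simp_rw [smul_sub, Finset.sum_sub_distrib, ← Finset.sum_smul, ← Finset.sum_div]
        rw [← Nat.cast_sum, div_self hN, one_smul, sacEstimator, Finset.smul_sum]
        simp_rw [smul_smul, inv_mul_eq_div]
      rw [h3, sum_inner]
      exact Finset.sum_congr rfl fun k _ => (real_inner_smul_left _ _ _).symm
    · filter_upwards [ae_all_iff.2 (hT.argmin m)] with ω hω
      refine ⟨trivial, fun k => by rw [add_sub_cancel]; exact (hω k).1, fun δ₁ _ hδ₁ => ?_⟩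
      refine Finset.sum_le_sum fun k _ => ?_
      rw [add_sub_cancel]
      exact (hω k).2 (hδ₁ k)

/-- Asymptotic normality of the full-sample estimator. -/
theorem tendstoInDistribution_full (hr : 0 < r) (hc : 0 < c)
    (hreg : ∀ k, BlockRegular (F k) M (Θ k) (join φs (ls k)) G c r) (hn : SampleSizes n γ)
    (hX : IsSample P X F)
    {T : ℕ → Ω → EuclideanSpace ℝ (Fin p₁) × (Fin K → EuclideanSpace ℝ (Fin p₂))}
    (hT : IsFullEstimator P M Θ X n T) :
    TendstoInDistribution (fun m ω => √(total n m) • ((T m ω).1 - φs)) atTop id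
      (fun _ => P) (multivariateGaussian 0 (covFull F M (fun k => join φs (ls k)) γ)) := by
  have hJ := fun k => (hreg k).posDef_partialHess hc
  -- `N → ∞` excludes `K = 0`, for which the empty sum `J` would be zero.
  have hK : (Finset.univ : Finset (Fin K)).Nonempty := by
    by_contra hcon
    rw [Finset.not_nonempty_iff_eq_empty] at hcon
    have := hn.total_tendsto
    simp only [hcon, Finset.sum_empty] at this
    exact not_tendsto_const_atTop _ _ this
  set J := ∑ k, γ k • partialHess (F k) M (join φs (ls k)) with hJdef
  have hJs : J.PosDef := Matrix.posDef_sum hK fun k _ => (hJ k).smul (hn.limit_pos k)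
  refine tendstoInDistribution_of_linear hc hreg hn hX
    (fun m => ((hT.aemeasurable m).fst.sub_const _).const_smul (√(total n m))) ?_
    (fun v _ => J⁻¹.mulVec v) (fun v => ?_) (fun v => ?_)
  · exact posSemidef_conj_inv hJs (Matrix.posSemidef_sum _ fun k _ =>
      ((hreg k).posSemidef_scoreVar hc).smul (hn.limit_pos k).le)
  · rw [covFull, dotProduct_conj_inv hJs, Matrix.sum_mulVec, dotProduct_sum]
    refine Finset.sum_congr rfl fun k _ => ?_
    rw [Matrix.smul_mulVec, dotProduct_smul, smul_eq_mul]
  -- The test direction must lie in `commonSubmodule`, so all blocks share `u = J⁻¹ v`. The limiting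
  -- weights `γ` are used because then `∑ γ_k J_k u = v` exactly.
  · have h1 := tendstoInMeasure_argmin hr hc hreg hn hX (q := fun _ => γ)
      (fun k => tendsto_const_nhds) (commonSubmodule p₁ p₂ K)
      (δ := fun m ω k => join (T m ω).1 ((T m ω).2 k) - join φs (ls k))
      (fun m k => ?_) (fun m => ?_)
      (h := fun k => schurDir (popHess (F k) M (join φs (ls k))) (J⁻¹.mulVec v))
      ⟨_, fun k => common_schurDir _ _⟩
    · refine h1.congr_left fun m => Eventually.of_forall fun ω => ?_
      simp only
      congr 1
      rw [Pi.smul_apply, inner_smul_left, RCLike.conj_to_real]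
      congr 1
      have h2 : ∀ k, γ k * ⟪Matrix.toEuclideanCLM (𝕜 := ℝ) (popHess (F k) M (join φs (ls k)))
          (join (T m ω).1 ((T m ω).2 k) - join φs (ls k)),
            schurDir (popHess (F k) M (join φs (ls k))) (J⁻¹.mulVec v)⟫_ℝ
          = ((T m ω).1 - φs).ofLp ⬝ᵥ
            (γ k • partialHess (F k) M (join φs (ls k))).mulVec (J⁻¹.mulVec v) := fun k => by
        rw [inner_popHess_schurDir ((hreg k).posDef hc), Matrix.smul_mulVec, dotProduct_smul,
          smul_eq_mul]
        rfl
      simp_rw [h2]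
      rw [← dotProduct_sum, ← Matrix.sum_mulVec, ← hJdef, mulVec_inv_mulVec hJs,
        EuclideanSpace.inner_eq_star_dotProduct, star_trivial, dotProduct_comm]
    · refine AEMeasurable.sub_const (continuous_join.measurable.comp_aemeasurable
        (f := fun ω => ((T m ω).1, (T m ω).2 k)) ((hT.aemeasurable m).fst.prodMk ?_)) _
      exact (measurable_pi_apply k).comp_aemeasurable (hT.aemeasurable m).snd
    · filter_upwards [hT.argmin m] with ω hω
      refine ⟨⟨(T m ω).1 - φs, fun k => rfl⟩, fun k => by rw [add_sub_cancel]; exact hω.1 k, ?_⟩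
      rintro δ' ⟨φ, hφ⟩ hδ'
      simp_rw [add_sub_cancel]
      -- A competitor with a common `φ`-displacement is rewritten as a point of the full parameter
      -- space, to which minimality applies.
      have h2 : ∀ k, join (φs + φ)
          (WithLp.toLp 2 fun b => (join φs (ls k) + δ' k) (Sum.inr b)) = join φs (ls k) + δ' k :=
        fun k => by
          rw [← hφ k]
          exact join_common (join φs (ls k) + δ' k)
      have h3 := hω.2 (show ((φs + φ, fun k => WithLp.toLp 2 fun b =>
          (join φs (ls k) + δ' k) (Sum.inr b)) : EuclideanSpace ℝ (Fin p₁) ×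
            (Fin K → EuclideanSpace ℝ (Fin p₂))) ∈ fullSpace Θ from fun k => by
        rw [h2]; exact hδ' k)
      simpa only [Set.mem_ofPred_eq, h2] using h3

end Estimators

/-! ### Quadratic functions -/

section Quadratic

/-- In the least squares example both the loss and its risk have this form, so their derivatives
come from one computation. Symmetry of `A` merges the two terms of the product rule. -/
theorem hasGradientAt_quadratic {A : Matrix (Fin p₁ ⊕ Fin p₂) (Fin p₁ ⊕ Fin p₂) ℝ}
    (hA : Matrix.transpose A = A) (b : Param p₁ p₂) (k : ℝ) {f : Param p₁ p₂ → ℝ}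
    (hf : ∀ θ, f θ = ⟪Matrix.toEuclideanCLM (𝕜 := ℝ) A θ, θ⟫_ℝ / 2 - ⟪b, θ⟫_ℝ + k)
    (θ : Param p₁ p₂) :
    HasGradientAt f (Matrix.toEuclideanCLM (𝕜 := ℝ) A θ - b) θ := by
  rw [funext hf, hasGradientAt_iff_hasFDerivAt]
  set L := Matrix.toEuclideanCLM (𝕜 := ℝ) A
  have h1 := (L.hasFDerivAt (x := θ)).inner ℝ (hasFDerivAt_id θ)
  have h2 := (innerSL ℝ b).hasFDerivAt (x := θ)
  have h3 := ((h1.const_mul (1 / 2)).sub h2).add_const k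
  refine (h3.congr_fderiv ?_).congr_of_eventuallyEq (Eventually.of_forall fun η => ?_)
  · ext u
    have hsymm : ⟪L u, θ⟫_ℝ = ⟪L θ, u⟫_ℝ := by
      simp only [L]
      rw [inner_toEuclideanCLM, inner_toEuclideanCLM, Matrix.dotProduct_mulVec,
        ← Matrix.mulVec_transpose, hA, dotProduct_comm]
    simp [hsymm]
    ring
  · simp
    ring

theorem gradient_quadratic {A : Matrix (Fin p₁ ⊕ Fin p₂) (Fin p₁ ⊕ Fin p₂) ℝ}
    (hA : Matrix.transpose A = A) (b : Param p₁ p₂) (k : ℝ) {f : Param p₁ p₂ → ℝ}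
    (hf : ∀ θ, f θ = ⟪Matrix.toEuclideanCLM (𝕜 := ℝ) A θ, θ⟫_ℝ / 2 - ⟪b, θ⟫_ℝ + k) :
    gradient f = fun θ => Matrix.toEuclideanCLM (𝕜 := ℝ) A θ - b :=
  funext fun θ => (hasGradientAt_quadratic hA b k hf θ).gradient

theorem twiceDifferentiableAt_quadratic {A : Matrix (Fin p₁ ⊕ Fin p₂) (Fin p₁ ⊕ Fin p₂) ℝ}
    (hA : Matrix.transpose A = A) (b : Param p₁ p₂) (k : ℝ) {f : Param p₁ p₂ → ℝ}
    (hf : ∀ θ, f θ = ⟪Matrix.toEuclideanCLM (𝕜 := ℝ) A θ, θ⟫_ℝ / 2 - ⟪b, θ⟫_ℝ + k)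
    (θ : Param p₁ p₂) : TwiceDifferentiableAt f θ := by
  refine ⟨Eventually.of_forall fun η =>
    (hasGradientAt_quadratic hA b k hf η).differentiableAt, ?_⟩
  rw [gradient_quadratic hA b k hf]
  fun_prop

theorem hess_quadratic {A : Matrix (Fin p₁ ⊕ Fin p₂) (Fin p₁ ⊕ Fin p₂) ℝ}
    (hA : Matrix.transpose A = A) (b : Param p₁ p₂) (k : ℝ) {f : Param p₁ p₂ → ℝ}
    (hf : ∀ θ, f θ = ⟪Matrix.toEuclideanCLM (𝕜 := ℝ) A θ, θ⟫_ℝ / 2 - ⟪b, θ⟫_ℝ + k)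
    (θ : Param p₁ p₂) : hess f θ = A := by
  have h := fderiv_gradient_eq_hess f θ
  rw [gradient_quadratic hA b k hf, fderiv_sub_const, ContinuousLinearMap.fderiv] at h
  exact ((Matrix.toEuclideanCLM (𝕜 := ℝ)).injective h).symm

end Quadratic

/-! ### Least squares with heteroscedastic blocks -/

/-- The regressor `(z, 1)` of the observation `x = (z, y)`. -/
noncomputable def regressor (x : Obs 2) : Param 1 1 :=
  WithLp.toLp 2 (Sum.elim (fun _ => x 0) fun _ => 1)

/-- The least squares loss `(y - z φ - λ)² / 2` of the observation `x = (z, y)`. -/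
noncomputable def lsq (x : Obs 2) (θ : Param 1 1) : ℝ := (x 1 - ⟪regressor x, θ⟫_ℝ) ^ 2 / 2

/-- The distribution of `(z, y)` with `z` and `y` independent and uniform on `{c, -c}`. -/
noncomputable def fourPoint (c : ℝ) : Measure (Obs 2) :=
  (4 : ENNReal)⁻¹ • (Measure.dirac !₂[c, c] + Measure.dirac !₂[c, -c] +
    Measure.dirac !₂[-c, c] + Measure.dirac !₂[-c, -c])

theorem lintegral_fourPoint (c : ℝ) (f : Obs 2 → ENNReal) :
    ∫⁻ x, f x ∂fourPoint c = (4 : ENNReal)⁻¹ *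
      (f !₂[c, c] + f !₂[c, -c] + f !₂[-c, c] + f !₂[-c, -c]) := by
  simp [fourPoint, lintegral_add_measure, mul_add]

instance (c : ℝ) : IsProbabilityMeasure (fourPoint c) := by
  refine ⟨?_⟩
  rw [← setLIntegral_one, Measure.restrict_univ, lintegral_fourPoint]
  norm_num
  exact ENNReal.inv_mul_cancel (by norm_num) (by norm_num)

theorem lintegral_fourPoint_lt_top (c : ℝ) {f : Obs 2 → ENNReal} (hf : ∀ x, f x < ⊤) :
    ∫⁻ x, f x ∂fourPoint c < ⊤ := by
  rw [lintegral_fourPoint]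
  refine ENNReal.mul_lt_top (by simp) ?_
  simp [ENNReal.add_lt_top, hf]

theorem integrable_fourPoint (c : ℝ) (f : Obs 2 → ℝ) : Integrable f (fourPoint c) := by
  have h : ∀ x : Obs 2, Integrable f (Measure.dirac x) := fun x => integrable_dirac (by simp)
  exact ((((h _).add_measure (h _)).add_measure (h _)).add_measure (h _)).smul_measure (by simp)

theorem integral_fourPoint (c : ℝ) (f : Obs 2 → ℝ) :
    ∫ x, f x ∂fourPoint c = (f !₂[c, c] + f !₂[c, -c] + f !₂[-c, c] + f !₂[-c, -c]) / 4 := by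
  have h : ∀ x : Obs 2, Integrable f (Measure.dirac x) := fun x => integrable_dirac (by simp)
  rw [fourPoint, integral_smul_measure, integral_add_measure
    (((h _).add_measure (h _)).add_measure (h _)) (h _), integral_add_measure
    ((h _).add_measure (h _)) (h _), integral_add_measure (h _) (h _)]
  simp
  ring

theorem inner_param (u w : Param 1 1) :
    ⟪u, w⟫_ℝ = u (Sum.inl 0) * w (Sum.inl 0) + u (Sum.inr 0) * w (Sum.inr 0) := by
  simp [PiLp.inner_apply, mul_comm]

/-- The rank one matrix `(z, 1) (z, 1)ᵀ`. -/
noncomputable def regressorOuter (x : Obs 2) : Matrix (Fin 1 ⊕ Fin 1) (Fin 1 ⊕ Fin 1) ℝ :=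
  Matrix.vecMulVec (regressor x) (regressor x)

theorem toEuclideanCLM_regressorOuter (x : Obs 2) (u : Param 1 1) :
    Matrix.toEuclideanCLM (𝕜 := ℝ) (regressorOuter x) u
      = ⟪regressor x, u⟫_ℝ • regressor x := by
  ext a
  rw [Matrix.ofLp_toEuclideanCLM, regressorOuter, Matrix.vecMulVec_mulVec]
  simp [EuclideanSpace.inner_eq_star_dotProduct, dotProduct_comm, mul_comm]

theorem norm_regressorOuter_le (x : Obs 2) : ‖regressorOuter x‖ ≤ ‖regressor x‖ ^ 2 := by
  rw [← Matrix.l2_opNorm_toEuclideanCLM]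
  refine ContinuousLinearMap.opNorm_le_bound _ (by positivity) fun u => ?_
  rw [toEuclideanCLM_regressorOuter, norm_smul]
  calc _ ≤ ‖regressor x‖ * ‖u‖ * ‖regressor x‖ :=
        mul_le_mul_of_nonneg_right (norm_inner_le_norm _ _) (norm_nonneg _)
    _ = _ := by ring

theorem transpose_regressorOuter (x : Obs 2) :
    Matrix.transpose (regressorOuter x) = regressorOuter x := Matrix.transpose_vecMulVec _ _

theorem lsq_eq (x : Obs 2) (θ : Param 1 1) :
    lsq x θ = ⟪Matrix.toEuclideanCLM (𝕜 := ℝ) (regressorOuter x) θ, θ⟫_ℝ / 2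
      - ⟪x 1 • regressor x, θ⟫_ℝ + x 1 ^ 2 / 2 := by
  rw [toEuclideanCLM_regressorOuter, real_inner_smul_left, real_inner_smul_left, lsq]
  ring

theorem gradient_lsq (x : Obs 2) (θ : Param 1 1) :
    gradient (lsq x) θ = -(x 1 - ⟪regressor x, θ⟫_ℝ) • regressor x := by
  rw [gradient_quadratic (transpose_regressorOuter x) _ _ (lsq_eq x)]
  simp only
  rw [toEuclideanCLM_regressorOuter, ← sub_smul, neg_sub]

theorem hess_lsq (x : Obs 2) (θ : Param 1 1) : hess (lsq x) θ = regressorOuter x :=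
  hess_quadratic (transpose_regressorOuter x) _ _ (lsq_eq x) θ

/-- The expected Hessian of the least squares loss. -/
noncomputable def riskHess (c : ℝ) : Matrix (Fin 1 ⊕ Fin 1) (Fin 1 ⊕ Fin 1) ℝ :=
  Matrix.diagonal (Sum.elim (fun _ => c ^ 2) fun _ => 1)

theorem popRisk_lsq (c : ℝ) (θ : Param 1 1) :
    popRisk (fourPoint c) lsq θ
      = (c ^ 2 + c ^ 2 * θ (Sum.inl 0) ^ 2 + θ (Sum.inr 0) ^ 2) / 2 := by
  rw [popRisk, integral_fourPoint]
  simp [lsq, inner_param, regressor]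
  ring

theorem popRisk_lsq_eq (c : ℝ) (θ : Param 1 1) :
    popRisk (fourPoint c) lsq θ = ⟪Matrix.toEuclideanCLM (𝕜 := ℝ) (riskHess c) θ, θ⟫_ℝ / 2
      - ⟪(0 : Param 1 1), θ⟫_ℝ + c ^ 2 / 2 := by
  rw [popRisk_lsq, inner_param, Matrix.ofLp_toEuclideanCLM, riskHess, inner_zero_left]
  simp [Matrix.mulVec_diagonal]
  ring

theorem hess_popRisk_lsq (c : ℝ) (θ : Param 1 1) :
    hess (popRisk (fourPoint c) lsq) θ = riskHess c :=
  hess_quadratic (Matrix.diagonal_transpose _) _ _ (popRisk_lsq_eq c) θ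

theorem popHess_lsq (c : ℝ) (θ : Param 1 1) : popHess (fourPoint c) lsq θ = riskHess c := by
  ext a b
  rw [popHess, Matrix.of_apply, integral_fourPoint]
  simp_rw [hess_lsq, regressorOuter, Matrix.vecMulVec_apply, riskHess, regressor]
  rcases a with a | a <;> rcases b with b | b <;> simp [Matrix.diagonal, Subsingleton.elim a b] <;>
    ring

theorem partialHess_lsq (c : ℝ) (θ : Param 1 1) :
    partialHess (fourPoint c) lsq θ = c ^ 2 • (1 : Matrix (Fin 1) (Fin 1) ℝ) := by
  rw [partialHess, popHess_lsq]
  ext a b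
  simp [riskHess, Matrix.toBlocks₁₁, Matrix.toBlocks₁₂, Matrix.toBlocks₂₁, Matrix.toBlocks₂₂,
    Subsingleton.elim a b, Matrix.mul_apply]

theorem adjScore_lsq (c : ℝ) (x : Obs 2) (a : Fin 1) :
    adjScore (fourPoint c) lsq 0 x a = -(x 1 * x 0) := by
  rw [adjScore, popHess_lsq]
  simp [riskHess, Matrix.toBlocks₁₂, gradient_lsq, regressor, Matrix.mulVec, dotProduct]

/-- The adjusted score is `-yz`, which takes the values `±c²` with equal probability. -/
theorem scoreVar_lsq (c : ℝ) :
    scoreVar (fourPoint c) lsq 0 = c ^ 4 • (1 : Matrix (Fin 1) (Fin 1) ℝ) := by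
  ext a b
  rw [scoreVar, Matrix.of_apply]
  simp_rw [adjScore_lsq, covariance, integral_fourPoint]
  simp [Subsingleton.elim a b]
  ring

theorem join_zero {p₁ p₂ : ℕ} : join (0 : EuclideanSpace ℝ (Fin p₁))
    (0 : EuclideanSpace ℝ (Fin p₂)) = 0 := by
  ext (a | b) <;> rfl

theorem convexOn_lsq (S : Set (Param 1 1)) (hS : Convex ℝ S) (x : Obs 2) :
    ConvexOn ℝ S (lsq x) := by
  refine ⟨hS, fun θ _ η _ a b ha hb hab => ?_⟩
  simp only [lsq, inner_add_right, real_inner_smul_right, smul_eq_mul]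
  obtain rfl : b = 1 - a := by linarith
  nlinarith [mul_nonneg (mul_nonneg ha hb)
    (sq_nonneg (⟪regressor x, θ⟫_ℝ - ⟪regressor x, η⟫_ℝ))]

theorem continuous_regressor : Continuous regressor := by
  refine (PiLp.continuous_toLp 2 _).comp (continuous_pi fun a => ?_)
  cases a <;> simp only [Sum.elim_inl, Sum.elim_inr] <;> fun_prop

theorem gradOuter_lsq (x : Obs 2) (θ : Param 1 1) :
    gradOuter (lsq x) θ = (x 1 - ⟪regressor x, θ⟫_ℝ) ^ 2 • regressorOuter x := by
  ext a b
  simp [gradOuter, gradient_lsq, regressorOuter, Matrix.vecMulVec_apply]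
  ring

/-- A Lipschitz constant of the outer product of the gradient on the unit ball. -/
noncomputable def outerLipschitz (x : Obs 2) : ℝ :=
  2 * (|x 1| + ‖regressor x‖) * ‖regressor x‖ ^ 3

theorem norm_gradOuter_lsq_sub_le (x : Obs 2) {θ η : Param 1 1} (hθ : ‖θ‖ ≤ 1) (hη : ‖η‖ ≤ 1) :
    ‖gradOuter (lsq x) θ - gradOuter (lsq x) η‖ ≤ outerLipschitz x * ‖θ - η‖ := by
  rw [gradOuter_lsq, gradOuter_lsq, ← sub_smul, norm_smul]
  have h1 : ∀ u : Param 1 1, ‖u‖ ≤ 1 → |⟪regressor x, u⟫_ℝ| ≤ ‖regressor x‖ := fun u hu =>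
    (abs_real_inner_le_norm _ _).trans (mul_le_of_le_one_right (norm_nonneg _) hu)
  have h2 : |⟪regressor x, θ - η⟫_ℝ| ≤ ‖regressor x‖ * ‖θ - η‖ := abs_real_inner_le_norm _ _
  -- Difference of squares: one factor is bounded on the unit ball, the other is linear in `θ - η`.
  have h3 : (x 1 - ⟪regressor x, θ⟫_ℝ) ^ 2 - (x 1 - ⟪regressor x, η⟫_ℝ) ^ 2
      = -((2 * x 1 - ⟪regressor x, θ⟫_ℝ - ⟪regressor x, η⟫_ℝ) * ⟪regressor x, θ - η⟫_ℝ) := by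
    rw [inner_sub_right]; ring
  have h4 : |2 * x 1 - ⟪regressor x, θ⟫_ℝ - ⟪regressor x, η⟫_ℝ|
      ≤ 2 * (|x 1| + ‖regressor x‖) := by
    refine (abs_sub _ _).trans ?_
    have := abs_sub (2 * x 1) ⟪regressor x, θ⟫_ℝ
    rw [abs_mul, abs_two] at this
    linarith [h1 θ hθ, h1 η hη]
  rw [h3, norm_neg, norm_mul, Real.norm_eq_abs, Real.norm_eq_abs]
  calc _ ≤ 2 * (|x 1| + ‖regressor x‖) * (‖regressor x‖ * ‖θ - η‖) * ‖regressor x‖ ^ 2 :=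
        mul_le_mul (mul_le_mul h4 h2 (abs_nonneg _) (by positivity)) (norm_regressorOuter_le x)
          (norm_nonneg _) (by positivity)
    _ = _ := by rw [outerLipschitz]; ring

/-- Supplies the moment constants of the example. The summand `1` in `R = 1 + ∑ a k` makes `R ≥ 1`,
hence `R ≤ R ^ 4`. -/
theorem exists_rpow_bound {K : ℕ} (a : Fin K → ENNReal) (ha : ∀ k, a k < ⊤) :
    ∃ R : ℝ, 0 < R ∧ ∀ k, a k ≤ ENNReal.ofReal (R ^ (2 * 2 : ℝ)) := by
  have h0 : 0 ≤ ∑ k, (a k).toReal := Finset.sum_nonneg fun k _ => ENNReal.toReal_nonneg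
  refine ⟨1 + ∑ k, (a k).toReal, by positivity, fun k => ?_⟩
  rw [← ENNReal.ofReal_toReal (ha k).ne]
  refine ENNReal.ofReal_le_ofReal ?_
  have h1 : (a k).toReal ≤ ∑ k, (a k).toReal :=
    Finset.single_le_sum (fun k _ => ENNReal.toReal_nonneg) (Finset.mem_univ k)
  calc (a k).toReal ≤ 1 + ∑ k, (a k).toReal := by linarith
    _ = (1 + ∑ k, (a k).toReal) ^ (1 : ℝ) := (Real.rpow_one _).symm
    _ ≤ _ := Real.rpow_le_rpow_of_exponent_le (by linarith) (by norm_num)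

/-- The least squares example satisfies the assumptions of the model. -/
theorem model_lsq {K : ℕ} {c : Fin K → ℝ} (hc : ∀ k, 1 ≤ c k) :
    Model lsq (fun k => fourPoint (c k)) (fun _ => Metric.closedBall 0 1) 0 (fun _ => 0) 2 2 := by
  refine ⟨fun k => inferInstance, fun k x => convexOn_lsq _ (convex_closedBall _ _) x, ?_, ?_, ?_,
    ?_⟩ <;> simp only [join_zero]
  · refine ⟨fun k θ _ => integrable_fourPoint _ _, fun k θ _ hθ => ?_⟩
    simp only [popRisk_lsq]
    have hck : 0 < c k ^ 2 := by have := hc k; positivity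
    have h : 0 < c k ^ 2 * θ (Sum.inl 0) ^ 2 + θ (Sum.inr 0) ^ 2 := by
      by_contra! hcon
      have e1 : θ (Sum.inl 0) = 0 := by
        by_contra hne
        have : 0 < θ (Sum.inl 0) ^ 2 := by positivity
        nlinarith [mul_pos hck this, sq_nonneg (θ (Sum.inr 0))]
      have e2 : θ (Sum.inr 0) = 0 := by
        have : 0 ≤ c k ^ 2 * θ (Sum.inl 0) ^ 2 := by positivity
        nlinarith [sq_nonneg (θ (Sum.inr 0))]
      exact hθ (by ext (a | a) <;> simp [Subsingleton.elim a 0, e1, e2])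
    simp only [PiLp.zero_apply]
    linarith
  · exact ⟨fun k => isCompact_closedBall _ _, fun k => convex_closedBall _ _, fun k =>
      Metric.ball_subset_interior_closedBall (Metric.mem_ball_self one_pos)⟩
  -- The constant `1` works because the Hessian of the risk is `diag (c k ^ 2, 1)` with `c k ≥ 1`.
  · refine ⟨1, one_pos, fun k => ⟨twiceDifferentiableAt_quadratic (Matrix.diagonal_transpose _) _ _
      (popRisk_lsq_eq (c k)) _, ?_⟩⟩
    rw [hess_popRisk_lsq, riskHess, one_smul, ← Matrix.diagonal_one, Matrix.diagonal_sub]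
    refine Matrix.PosSemidef.diagonal fun a => ?_
    rcases a with a | a
    · simp only [Pi.zero_apply, Sum.elim_inl]
      nlinarith [hc k]
    · simp
  · obtain ⟨R, hR, hR'⟩ := exists_rpow_bound
      (fun k => ∫⁻ x, ‖gradient (lsq x) 0‖ₑ ^ (2 * 2 : ℝ) ∂fourPoint (c k))
      fun k => lintegral_fourPoint_lt_top _ fun x =>
        ENNReal.rpow_lt_top_of_nonneg (by norm_num) enorm_ne_top
    obtain ⟨L, hL, hL'⟩ := exists_rpow_bound (fun k => ∫⁻ x, ‖hess (lsq x) 0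
        - hess (popRisk (fourPoint (c k)) lsq) 0‖ₑ ^ (2 * 2 : ℝ) ∂fourPoint (c k))
      fun k => lintegral_fourPoint_lt_top _ fun x =>
        ENNReal.rpow_lt_top_of_nonneg (by norm_num) enorm_ne_top
    obtain ⟨B₀, hB, hB'⟩ := exists_rpow_bound
      (fun k => ∫⁻ x, ‖outerLipschitz x‖ₑ ^ (2 * 2 : ℝ) ∂fourPoint (c k))
      fun k => lintegral_fourPoint_lt_top _ fun x =>
        ENNReal.rpow_lt_top_of_nonneg (by norm_num) enorm_ne_top
    -- The Hessian of the loss does not depend on the parameter, so its Lipschitz function is `0`;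
    -- the moment bound `G₀ = 1` is just a positive number.
    refine ⟨R, L, 1, B₀, 1, fun _ => 0, outerLipschitz, hR, hL, one_pos, hB, one_pos,
      measurable_const, ?_, fun k => ⟨fun x θ _ => twiceDifferentiableAt_quadratic
        (transpose_regressorOuter x) _ _ (lsq_eq x) θ, hR' k, hL' k, fun x θ hθ η hη => ⟨?_, ?_⟩,
        ?_, hB' k⟩⟩
    · have := continuous_regressor
      unfold outerLipschitz
      exact Continuous.measurable (by fun_prop)
    · simp [hess_lsq]
    · exact norm_gradOuter_lsq_sub_le x (by simpa using hθ) (by simpa using hη)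
    · simp

theorem sampleSizes_balanced : SampleSizes (K := 2) (fun m _ => m) (fun _ => 1 / 2) where
  total_tendsto := by
    simp only [Finset.sum_const, Finset.card_univ, Fintype.card_fin, smul_eq_mul]
    exact tendsto_id.const_mul_atTop' two_pos
  ratio_tendsto k := by
    refine tendsto_const_nhds.congr' ?_
    filter_upwards [eventually_gt_atTop 0] with m hm
    have : (m : ℝ) ≠ 0 := by positivity
    simp
    field_simp
  limit_pos k := by norm_num

theorem inv_smul_one {a : ℝ} (ha : a ≠ 0) :
    (a • (1 : Matrix (Fin 1) (Fin 1) ℝ))⁻¹ = a⁻¹ • (1 : Matrix (Fin 1) (Fin 1) ℝ) :=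
  Matrix.inv_eq_left_inv (by rw [Matrix.smul_mul, Matrix.mul_smul, Matrix.mul_one, smul_smul,
    inv_mul_cancel₀ ha, one_smul])

/-- The scales of the two blocks of the least squares example. -/
noncomputable def scale : Fin 2 → ℝ := ![1, 2]

theorem one_le_scale (k : Fin 2) : 1 ≤ scale k := by
  fin_cases k <;> norm_num [scale]

/-- Each block contributes `c⁻² * c⁴ * c⁻² = 1`, whatever its scale. -/
theorem covSaC_lsq : covSaC (fun k => fourPoint (scale k)) lsq (fun _ => 0) (fun _ => 1 / 2)
    = (1 : Matrix (Fin 1) (Fin 1) ℝ) := by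
  have h : ∀ k, scale k ^ 2 ≠ 0 := fun k => by have := one_le_scale k; positivity
  simp only [covSaC, partialHess_lsq, scoreVar_lsq, inv_smul_one (h _)]
  ext a b
  obtain rfl := Subsingleton.elim a b
  simp [Fin.sum_univ_two, scale]
  norm_num

/-- The mean of `c⁴` over the squared mean of `c²`, which exceeds 1 as soon as the scales differ. -/
theorem covFull_lsq : covFull (fun k => fourPoint (scale k)) lsq (fun _ => 0) (fun _ => 1 / 2)
    = (34 / 25 : ℝ) • (1 : Matrix (Fin 1) (Fin 1) ℝ) := by
  simp only [covFull, partialHess_lsq, scoreVar_lsq, Fin.sum_univ_two, smul_smul, ← add_smul]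
  rw [inv_smul_one (by norm_num [scale])]
  ext a b
  simp [scale, Subsingleton.elim a b]
  norm_num

theorem not_posSemidef_covSaC_sub_covFull_lsq :
    ¬ (covSaC (fun k => fourPoint (scale k)) lsq (fun _ => 0) (fun _ => 1 / 2) -
      covFull (fun k => fourPoint (scale k)) lsq (fun _ => 0) (fun _ => 1 / 2)).PosSemidef := by
  rw [covSaC_lsq, covFull_lsq]
  intro h
  have := h.diag_nonneg (i := 0)
  norm_num at this

end SaC

/-! ### Main theorem -/

theorem mainTheorem6 :
    -- asymptotic normality of both estimators
    (∀ (d p₁ p₂ K : ℕ) (M : SaC.Obs d → SaC.Param p₁ p₂ → ℝ) (F : Fin K → Measure (SaC.Obs d))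
      (Θ : Fin K → Set (SaC.Param p₁ p₂)) (φs : EuclideanSpace ℝ (Fin p₁))
      (ls : Fin K → EuclideanSpace ℝ (Fin p₂)) (v v₁ : ℝ) (n : ℕ → Fin K → ℕ) (γ : Fin K → ℝ)
      (Ω : Type*) [MeasurableSpace Ω] (P : Measure Ω) [IsProbabilityMeasure P]
      (X : Fin K → ℕ → Ω → SaC.Obs d) (Tloc : ℕ → Fin K → Ω → SaC.Param p₁ p₂)
      (Tfull : ℕ → Ω → EuclideanSpace ℝ (Fin p₁) × (Fin K → EuclideanSpace ℝ (Fin p₂))),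
      2 ≤ v → 2 ≤ v₁ → SaC.Model M F Θ φs ls v v₁ → SaC.SampleSizes n γ →
      SaC.IsSample P X F → SaC.IsLocalEstimator P M Θ X n Tloc →
      SaC.IsFullEstimator P M Θ X n Tfull →
      (∀ k, ((SaC.popHess (F k) M (SaC.join φs (ls k))).toBlocks₂₂).PosDef ∧
        (SaC.partialHess (F k) M (SaC.join φs (ls k))).PosDef) ∧
      TendstoInDistribution
        (fun m ω => √((∑ k, n m k : ℕ) : ℝ) • (SaC.sacEstimator n Tloc m ω - φs)) atTop id
        (fun _ => P) (multivariateGaussian 0 (SaC.covSaC F M (fun k => SaC.join φs (ls k)) γ)) ∧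
      TendstoInDistribution
        (fun m ω => √((∑ k, n m k : ℕ) : ℝ) • ((Tfull m ω).1 - φs)) atTop id
        (fun _ => P) (multivariateGaussian 0 (SaC.covFull F M (fun k => SaC.join φs (ls k)) γ)))
    ∧
    -- the limiting covariance of the full-sample estimator need not be below that of SaC
    (∃ (d p₁ p₂ K : ℕ) (M : SaC.Obs d → SaC.Param p₁ p₂ → ℝ) (F : Fin K → Measure (SaC.Obs d))
      (Θ : Fin K → Set (SaC.Param p₁ p₂)) (φs : EuclideanSpace ℝ (Fin p₁))
      (ls : Fin K → EuclideanSpace ℝ (Fin p₂)) (v v₁ : ℝ) (n : ℕ → Fin K → ℕ) (γ : Fin K → ℝ),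
      0 < p₂ ∧ 2 ≤ v ∧ 2 ≤ v₁ ∧ SaC.Model M F Θ φs ls v v₁ ∧ SaC.SampleSizes n γ ∧
      ¬ (SaC.covSaC F M (fun k => SaC.join φs (ls k)) γ -
          SaC.covFull F M (fun k => SaC.join φs (ls k)) γ).PosSemidef) := by
  refine ⟨?_, ?_⟩
  · intro d p₁ p₂ K M F Θ φs ls v v₁ n γ Ω _ P _ X Tloc Tfull hv hv₁ hM hn hX hloc hfull
    obtain ⟨G, c, r, hc, hr, hreg⟩ := hM.blockRegular hv hv₁
    have := hM.prob
    exact ⟨fun k => ⟨SaC.posDef_toBlocks₂₂ ((hreg k).posDef hc), (hreg k).posDef_partialHess hc⟩,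
      SaC.tendstoInDistribution_sac hr hc hreg hn hX hloc,
      SaC.tendstoInDistribution_full hr hc hreg hn hX hfull⟩
  · refine ⟨2, 1, 1, 2, SaC.lsq, fun k => SaC.fourPoint (SaC.scale k),
      fun _ => Metric.closedBall 0 1, 0, fun _ => 0, 2, 2, fun m _ => m, fun _ => 1 / 2, one_pos,
      le_rfl, le_rfl, SaC.model_lsq SaC.one_le_scale, SaC.sampleSizes_balanced, ?_⟩
    simpa only [SaC.join_zero] using SaC.not_posSemidef_covSaC_sub_covFull_lsq
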